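/- Let $\Omega\subset\mathbb{R}^2$ be a bounded polygonal domain: a nonempty, bounded, connected open set that is the interior of its closure and whose boundary lies on finitely many line segments (for instance, any bounded polygonal domain with Lipschitz boundary). Let $\{\mathcal{T}_h\}$ be a quasi-uniform family of (conforming, finite) triangulations of $\Omega$: for some $\kappa>0$, independent of the member of the family, each triangle $T\in\mathcal{T}_h$ contains a disc of radius $\kappa h$, where $h$ is the largest diameter of a triangle of $\mathcal{T}_h$. Fix an integer $j\ge 0$. Let $S_h^0(j,j)$ be the space of pairs $\phi=\{\phi_0,\phi_b\}$ where $\phi_0$ is, on each triangle $T\in\mathcal{T}_h$, a polynomial of degree at most $j$, and $\phi_b$ is, on each edge $e$ of $\mathcal{T}_h$, a (single) polynomial of degree at most $j$, with $\phi_b=0$ on each edge contained in $\partial\Omega$. Let $V(T,j+1)=[P_j(T)]^2+\hat P_j(T)\,\mathbf{x}$ be the Raviart–Thomas space of order $j$, where $P_j(T)$ denotes the polynomials on $T$ of degree at most $j$, $\hat P_j(T)$ the homogeneous ones of degree $j$, and $\mathbf{x}$ the position vector. The discrete weak gradient $\nabla_d\phi$ is defined on each $T$ as the unique element of $V(T,j+1)$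 with $$\int_T \nabla_d\phi\cdot \mathbf{q}\,dx=-\int_T\phi_0\,\nabla\cdot\mathbf{q}\,dx+\int_{\partial T}\phi_b\,\mathbf{q}\cdot\mathbf{n}\,ds\qquad\text{for all }\mathbf{q}\in V(T,j+1),$$ where $\mathbf{n}$ is the outward unit normal of $\partial T$. Then there is a constant $C>0$, independent of $h$ (that is, the same for all triangulations of the family) and of $\phi$, such that for each $\mathcal{T}_h$ in the family and each $\phi\in S_h^0(j,j)$ $$\|\phi\|\le C\,\|\nabla_d\phi\|,$$ where $\|\phi\|=\big(\sum_{T}\int_T\phi_0^2\,dx\big)^{1/2}$ and $\|\nabla_d\phi\|=\big(\sum_{T}\int_T|\nabla_d\phi|^2\,dx\big)^{1/2}$ are the $L^2(\Omega)$ norms. -/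

import Mathlib

open MeasureTheory Set
open scoped RealInnerProductSpace

noncomputable section

namespace WeakGalerkin

/-- The Euclidean plane, with the Euclidean norm and the Lebesgue measure. -/
abbrev Plane : Type := EuclideanSpace ℝ (Fin 2)

/-! ### Polynomials on the plane -/

/-- Real polynomials in the two Cartesian coordinates. -/
abbrev Poly : Type := MvPolynomial (Fin 2) ℝ

/-- The value of a polynomial at a point of the plane. -/
def Poly.at (p : Poly) (x : Plane) : ℝ := MvPolynomial.eval (fun i => x i) p

/-- `f ∈ P_m(A)`: on the set `A`, `f` coincides with a polynomial of (total) degree at most `m`.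
When `A` is a segment, these are the polynomials of degree at most `m` in arc length. -/
def IsPolyOn (m : ℕ) (A : Set Plane) (f : Plane → ℝ) : Prop :=
  ∃ p : Poly, p.totalDegree ≤ m ∧ ∀ x ∈ A, f x = p.at x

/-- Polynomial vector fields on the plane. -/
abbrev PolyField : Type := Fin 2 → Poly

/-- The value of a polynomial vector field at a point. -/
def PolyField.at (q : PolyField) (x : Plane) : Plane := !₂[(q 0).at x, (q 1).at x]

/-- The divergence `∂₁q₁ + ∂₂q₂`. -/
def PolyField.div (q : PolyField) : Poly := ∑ i, MvPolynomial.pderiv i (q i)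

/-- The map `p ↦ p 𝐱`, where `𝐱 = (x₁, x₂)` is the position vector. -/
def mulPosition : Poly →ₗ[ℝ] PolyField :=
  LinearMap.pi fun i => LinearMap.mulRight ℝ (MvPolynomial.X i)

/-- The Raviart–Thomas space of order `j`: `[P_j]² + P̂_j 𝐱`, with `P̂_j` the homogeneous
polynomials of degree `j`. Its elements have components of degree at most `j + 1`. A polynomial
on a triangle is determined by its values there, so the local space `V(T, j+1)` is represented by
this one space of polynomial fields. -/
def RT (j : ℕ) : Submodule ℝ PolyField :=
  Submodule.pi univ (fun _ => MvPolynomial.restrictTotalDegree (Fin 2) ℝ j) ⊔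
    (MvPolynomial.homogeneousSubmodule (Fin 2) ℝ j).map mulPosition

/-! ### Domains and triangulations -/

/-- A polygonal domain: a bounded, connected, nonempty open set that is the interior of its
closure and whose boundary lies on finitely many line segments. Every bounded polygonal domain
with Lipschitz boundary is of this kind. -/
structure IsPolygonalDomain (Ω : Set Plane) : Prop where
  isOpen : IsOpen Ω
  isConnected : IsConnected Ω
  isBounded : Bornology.IsBounded Ω
  interior_closure : interior (closure Ω) = Ω
  polygonal : ∃ S : Finset (Plane × Plane), frontier Ω ⊆ ⋃ s ∈ S, segment ℝ s.1 s.2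

/-- A (conforming) triangulation of `Ω`: a finite simplicial complex with union the closure of `Ω`,
each face of which is a face of a triangle. Faces are given by their sets of vertices. -/
structure Triangulation (Ω : Set Plane) where
  complex : Geometry.SimplicialComplex ℝ Plane
  finite : complex.faces.Finite
  pure : ∀ s ∈ complex.faces, ∃ t ∈ complex.faces, s ⊆ t ∧ t.card = 3
  space_eq : complex.space = closure Ω

namespace Triangulation

variable {Ω : Set Plane} (𝒯 : Triangulation Ω)

/-- The triangles, given by their three vertices. -/
abbrev Triangle : Type := {T : Finset Plane // T ∈ 𝒯.complex.faces ∧ T.card = 3}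

/-- The edges, given by their two endpoints. -/
abbrev Edge : Type := {e : Finset Plane // e ∈ 𝒯.complex.faces ∧ e.card = 2}

instance : Fintype 𝒯.Triangle :=
  (𝒯.finite.subset fun _ h => h.1 :
    {T : Finset Plane | T ∈ 𝒯.complex.faces ∧ T.card = 3}.Finite).fintype

variable {𝒯}

/-- The vertex set of a triangle. -/
abbrev Triangle.vertices (T : 𝒯.Triangle) : Finset Plane := T.1

/-- The closed triangle as a subset of the plane. -/
def Triangle.carrier (T : 𝒯.Triangle) : Set Plane := convexHull ℝ (T.1 : Set Plane)

/-- The closed edge as a subset of the plane. -/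
def Edge.carrier (e : 𝒯.Edge) : Set Plane := convexHull ℝ (e.1 : Set Plane)

open Classical in
/-- The edge of the triangle `T` opposite to its vertex `a`. -/
def Triangle.edge (T : 𝒯.Triangle) (a : T.vertices) : 𝒯.Edge :=
  ⟨T.1.erase a.1, by
    have hc : (T.1.erase a.1).card = 2 := by
      have h := Finset.card_erase_of_mem (s := T.1) (a := a.1) a.2
      rw [T.2.2] at h
      exact h
    exact ⟨𝒯.complex.down_closed T.2.1 (Finset.erase_subset _ _)
      (Finset.card_pos.mp (by omega)), hc⟩⟩

/-- The vector from `a` perpendicular to the line of the opposite edge, ending on that line. -/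
def Triangle.altitude (T : 𝒯.Triangle) (a : T.vertices) : Plane :=
  (vectorSpan ℝ ((T.edge a).1 : Set Plane))ᗮ.starProjection
    ((T.edge a).1.centroid ℝ id - a.1)

/-- The unit normal, pointing out of `T`, on the edge of `T` opposite to `a`. -/
def Triangle.normal (T : 𝒯.Triangle) (a : T.vertices) : Plane :=
  ‖T.altitude a‖⁻¹ • T.altitude a

variable (𝒯) in
/-- The mesh size: the largest diameter of a triangle. -/
def meshSize : ℝ := ⨆ T : 𝒯.Triangle, Metric.diam T.carrier

end Triangulation

/-- A family of triangulations of `Ω` is quasi-uniform if, for some `κ > 0`, every triangle of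
every member contains a disc of radius `κ h`, where `h` is the mesh size of that member. -/
def QuasiUniform {Ω : Set Plane} {ι : Type*} (𝒯 : ι → Triangulation Ω) : Prop :=
  ∃ κ : ℝ, 0 < κ ∧ ∀ i, ∀ T : (𝒯 i).Triangle,
    ∃ x : Plane, Metric.closedBall x (κ * (𝒯 i).meshSize) ⊆ T.carrier

/-! ### Discrete weak functions -/

/-- The weak finite element space `S_h(j, l)`: on each triangle `T` a polynomial `v₀` of degree at
most `j`, and on each edge `e` one polynomial `v_b` of degree at most `l` (shared by the triangles
that have `e` as an edge). Only the values of `v0 T` on `T` and of `vb e` on `e` are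
meaningful. -/
structure Sh {Ω : Set Plane} (𝒯 : Triangulation Ω) (j l : ℕ) where
  v0 : 𝒯.Triangle → Plane → ℝ
  vb : 𝒯.Edge → Plane → ℝ
  v0_poly : ∀ T, IsPolyOn j T.carrier (v0 T)
  vb_poly : ∀ e, IsPolyOn l e.carrier (vb e)

/-- The subspace `S_h^0(j, l)`: the boundary component vanishes on the edges on `∂Ω`. -/
def Sh0 {Ω : Set Plane} (𝒯 : Triangulation Ω) (j l : ℕ) : Set (Sh 𝒯 j l) :=
  {v | ∀ e : 𝒯.Edge, e.carrier ⊆ frontier Ω → ∀ x ∈ e.carrier, v.vb e x = 0}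

namespace Sh

variable {Ω : Set Plane} {𝒯 : Triangulation Ω} {j l : ℕ}

/-- `G` is the discrete weak gradient of `v` on `T`, taken in the Raviart–Thomas space of order `k`:
`∫_T G·q = -∫_T v₀ div q + ∫_{∂T} v_b q·n` for each test field `q`. Line integrals are taken with
respect to the one-dimensional Hausdorff measure, that is, arc length. -/
def IsWeakGradient (v : Sh 𝒯 j l) (k : ℕ) (T : 𝒯.Triangle) (G : RT k) : Prop :=
  ∀ q : RT k,
    ∫ x in T.carrier, ⟪G.1.at x, q.1.at x⟫ =
      -(∫ x in T.carrier, v.v0 T x * q.1.div.at x) +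
        ∑ a : T.vertices, ∫ x in (T.edge a).carrier,
          v.vb (T.edge a) x * ⟪q.1.at x, T.normal a⟫ ∂(Measure.hausdorffMeasure 1)

end Sh

/-! ### The discrete weak gradient is well defined -/

section

variable {Ω : Set Plane} {𝒯 : Triangulation Ω}

theorem continuous_at (p : Poly) : Continuous p.at :=
  (MvPolynomial.continuous_eval p).comp (by fun_prop)

theorem continuous_field_at (p : PolyField) : Continuous p.at := by
  have h0 := continuous_at (p 0)
  have h1 := continuous_at (p 1)
  refine (PiLp.continuous_toLp 2 _).comp (continuous_pi fun i => ?_)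
  fin_cases i
  · simpa using h0
  · simpa using h1

theorem field_at_add (p q : PolyField) (x : Plane) :
    (p + q).at x = p.at x + q.at x := by
  ext i; fin_cases i <;> simp [PolyField.at, Poly.at]

theorem field_at_smul (c : ℝ) (p : PolyField) (x : Plane) :
    (c • p).at x = c • p.at x := by
  ext i; fin_cases i <;> simp [PolyField.at, Poly.at]

theorem div_add_at (p q : PolyField) (x : Plane) :
    (p + q).div.at x = p.div.at x + q.div.at x := by
  simp [PolyField.div, Poly.at, Fin.sum_univ_two]; ring

theorem div_smul_at (c : ℝ) (p : PolyField) (x : Plane) :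
    (c • p).div.at x = c * p.div.at x := by
  simp [PolyField.div, Poly.at, Fin.sum_univ_two, mul_add, MvPolynomial.smul_eval]

theorem poly_eq_zero {p : Poly} {U : Set Plane} (hU : IsOpen U)
    (hne : U.Nonempty) (h : ∀ x ∈ U, p.at x = 0) : p = 0 := by
  obtain ⟨x, hx⟩ := hne
  have hV : IsOpen ((fun y : Fin 2 → ℝ => WithLp.toLp 2 y) ⁻¹' U) :=
    hU.preimage (PiLp.continuous_toLp 2 _)
  obtain ⟨ε, hε, hb⟩ := Metric.isOpen_iff.1 hV (fun i => x i) hx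
  refine MvPolynomial.funext_set (fun i => Metric.ball (x i) ε) (fun i => ?_) fun y hy => ?_
  · rw [Real.ball_eq_Ioo]
    exact Ioo_infinite (by linarith)
  · rw [← ball_pi _ hε] at hy
    simpa [Poly.at] using h _ (hb hy)

instance finiteDimensional_RT (j : ℕ) : FiniteDimensional ℝ (RT j) := by
  have h1 : (Submodule.pi univ
      (fun _ : Fin 2 => MvPolynomial.restrictTotalDegree (Fin 2) ℝ j)).FG := by
    exact Submodule.fg_pi fun i => Module.Finite.iff_fg.1 inferInstance
  have h2 := (MvPolynomial.homogeneousSubmodule_fg (σ := Fin 2) (R := ℝ) j).map mulPosition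
  exact Module.Finite.iff_fg.2 (h1.sup h2)

theorem isCompact_carrier (T : 𝒯.Triangle) : IsCompact T.carrier :=
  T.1.finite_toSet.isCompact_convexHull (𝕜 := ℝ)

theorem interior_carrier_nonempty (T : 𝒯.Triangle) :
    (interior T.carrier).Nonempty := by
  rw [Triangulation.Triangle.carrier, interior_convexHull_nonempty_iff_affineSpan_eq_top]
  have h := 𝒯.complex.indep T.2.1
  have := (h.affineSpan_eq_top_iff_card_eq_finrank_add_one).2 (by simp [T.2.2])
  simpa using this

/-- A polynomial field with vanishing square integral on a triangle is zero. -/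
theorem field_eq_zero (T : 𝒯.Triangle) (p : PolyField)
    (h : ∫ x in T.carrier, ⟪p.at x, p.at x⟫ = 0) : p = 0 := by
  have hc : Continuous fun x => ⟪p.at x, p.at x⟫ :=
    (continuous_field_at p).inner (continuous_field_at p)
  have h0 : ∀ x ∈ interior T.carrier, ⟪p.at x, p.at x⟫ = 0 := by
    have hae := (setIntegral_eq_zero_iff_of_nonneg_ae
      (Filter.Eventually.of_forall fun x => real_inner_self_nonneg)
      (hc.continuousOn.integrableOn_compact (isCompact_carrier T))).1 h
    have hae' := ae_restrict_of_ae_restrict_of_subset (μ := volume)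
      (interior_subset (s := T.carrier)) hae
    exact Measure.eqOn_open_of_ae_eq hae' isOpen_interior hc.continuousOn continuousOn_const
  have h1 : ∀ x ∈ interior T.carrier, p.at x = 0 := fun x hx =>
    inner_self_eq_zero.1 (h0 x hx)
  funext i
  refine poly_eq_zero isOpen_interior (interior_carrier_nonempty T) fun x hx => ?_
  have := congrArg (fun y : Plane => y i) (h1 x hx)
  fin_cases i <;> simpa [PolyField.at] using this

theorem hausdorffMeasure_edge_lt_top (e : 𝒯.Edge) :
    (Measure.hausdorffMeasure 1 : Measure Plane) e.carrier < ⊤ := by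
  obtain ⟨e, he, hc⟩ := e
  obtain ⟨a, b, -, rfl⟩ := Finset.card_eq_two.1 hc
  simp [Triangulation.Edge.carrier, convexHull_pair, hausdorffMeasure_segment, edist_lt_top]

end

namespace Sh

variable {Ω : Set Plane} {𝒯 : Triangulation Ω} {j l : ℕ}

theorem continuousOn_of_isPolyOn {m : ℕ} {A : Set Plane} {f : Plane → ℝ} (h : IsPolyOn m A f) :
    ContinuousOn f A := by
  obtain ⟨p, -, hp⟩ := h
  exact (continuous_at p).continuousOn.congr hp

theorem integrableOn_triangle (v : Sh 𝒯 j l) (T : 𝒯.Triangle) (q : PolyField) :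
    IntegrableOn (fun x => v.v0 T x * q.div.at x) T.carrier :=
  ((continuousOn_of_isPolyOn (v.v0_poly T)).mul
    (continuous_at q.div).continuousOn).integrableOn_compact (isCompact_carrier T)

theorem integrableOn_edge (v : Sh 𝒯 j l) (T : 𝒯.Triangle) (a : T.vertices) (q : PolyField) :
    IntegrableOn (fun x => v.vb (T.edge a) x * ⟪q.at x, T.normal a⟫) (T.edge a).carrier
      (Measure.hausdorffMeasure 1) := by
  have hK : IsCompact (T.edge a).carrier := (T.edge a).1.finite_toSet.isCompact_convexHull (𝕜 := ℝ)
  have hf : ContinuousOn (fun x => v.vb (T.edge a) x * ⟪q.at x, T.normal a⟫) (T.edge a).carrier :=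
    (continuousOn_of_isPolyOn (v.vb_poly _)).mul
      ((continuous_field_at q).inner continuous_const).continuousOn
  obtain ⟨C, hC⟩ := hK.exists_bound_of_continuousOn hf
  exact IntegrableOn.of_bound (hausdorffMeasure_edge_lt_top _)
    (hf.aestronglyMeasurable hK.measurableSet) C
    ((ae_restrict_iff' hK.measurableSet).2 (Filter.Eventually.of_forall hC))

/-- The discrete weak gradient exists and is unique. -/
theorem existsUnique_isWeakGradient (v : Sh 𝒯 j l) (k : ℕ) (T : 𝒯.Triangle) :
    ∃! G : RT k, v.IsWeakGradient k T G := by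
  have hint : ∀ p q : PolyField, IntegrableOn (fun x => ⟪p.at x, q.at x⟫) T.carrier :=
    fun p q => ((continuous_field_at p).inner
      (continuous_field_at q)).continuousOn.integrableOn_compact (isCompact_carrier T)
  let B : RT k →ₗ[ℝ] RT k →ₗ[ℝ] ℝ := LinearMap.mk₂ ℝ
    (fun p q => ∫ x in T.carrier, ⟪p.1.at x, q.1.at x⟫)
    (fun p p' q => by
      simp only [Submodule.coe_add, field_at_add, inner_add_left]
      exact integral_add (hint _ _) (hint _ _))
    (fun c p q => by
      simp only [Submodule.coe_smul, field_at_smul, real_inner_smul_left, smul_eq_mul]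
      exact integral_const_mul _ _)
    (fun p q q' => by
      simp only [Submodule.coe_add, field_at_add, inner_add_right]
      exact integral_add (hint _ _) (hint _ _))
    (fun c p q => by
      simp only [Submodule.coe_smul, field_at_smul, real_inner_smul_right, smul_eq_mul]
      exact integral_const_mul _ _)
  let L : RT k →ₗ[ℝ] ℝ :=
    { toFun := fun q => -(∫ x in T.carrier, v.v0 T x * q.1.div.at x) +
        ∑ a : T.vertices, ∫ x in (T.edge a).carrier,
          v.vb (T.edge a) x * ⟪q.1.at x, T.normal a⟫ ∂(Measure.hausdorffMeasure 1)
      map_add' := fun p q => by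
        simp only [Submodule.coe_add, field_at_add, inner_add_left, div_add_at, mul_add]
        rw [integral_add (integrableOn_triangle v T _) (integrableOn_triangle v T _),
          Finset.sum_congr rfl fun a _ =>
            integral_add (integrableOn_edge v T a p.1) (integrableOn_edge v T a q.1),
          Finset.sum_add_distrib]
        ring
      map_smul' := fun c q => by
        simp only [Submodule.coe_smul, field_at_smul, real_inner_smul_left, div_smul_at,
          mul_left_comm _ c, integral_const_mul, smul_eq_mul, RingHom.id_apply]
        rw [← Finset.mul_sum]
        ring }
  have hinj : Function.Injective B := by
    rw [injective_iff_map_eq_zero]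
    intro p hp
    exact Subtype.ext (field_eq_zero T p.1 (by simpa [B] using LinearMap.congr_fun hp p))
  have hsurj : Function.Surjective B :=
    (LinearMap.injective_iff_surjective_of_finrank_eq_finrank
      (Subspace.dual_finrank_eq (K := ℝ) (V := RT k)).symm).1 hinj
  obtain ⟨G, hG⟩ := hsurj L
  refine ⟨G, fun q => LinearMap.congr_fun hG q, fun G' hG' => hinj ?_⟩
  rw [hG]
  exact LinearMap.ext hG'

/-- The discrete weak gradient `∇_d v` of `v` on the triangle `T`, in the Raviart–Thomas space of
order `k`. -/
def weakGradient (v : Sh 𝒯 j l) (k : ℕ) (T : 𝒯.Triangle) : RT k :=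
  (v.existsUnique_isWeakGradient k T).choose

theorem weakGradient_spec (v : Sh 𝒯 j l) (k : ℕ) (T : 𝒯.Triangle) :
    v.IsWeakGradient k T (v.weakGradient k T) :=
  (v.existsUnique_isWeakGradient k T).choose_spec.1

/-- The `L²(Ω)` norm of `v`, that is, of its interior component `v₀`. -/
def l2Norm (v : Sh 𝒯 j l) : ℝ :=
  √(∑ T : 𝒯.Triangle, ∫ x in T.carrier, v.v0 T x ^ 2)

/-- The `L²(Ω)` norm of the discrete weak gradient of `v`, taken in the Raviart–Thomas space of
order `k` on each triangle. -/
def l2NormWeakGradient (v : Sh 𝒯 j l) (k : ℕ) : ℝ :=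
  √(∑ T : 𝒯.Triangle, ∫ x in T.carrier, ‖(v.weakGradient k T).1.at x‖ ^ 2)

end Sh

end WeakGalerkin

end

/-!
The proof is a discrete Poincaré argument without Sobolev spaces.

*Locally*, the discrete weak gradient is tested with the radial fields `p (x - a)`, where `a` is a
vertex of the triangle and `p` has degree at most `j`. They lie in the Raviart–Thomas space, have no
flux through the two edges at `a`, and have normal component a multiple of `p` on the third edge.
On the reference triangle, with coordinates `u`, `v`, if all these moments of `{f, b}` vanish, then
`f` is constant and equal to `b` on the boundary. Indeed the tests with `p = -u f_u`, centred at
`(1, 0)`, and `p = -v f_v`, centred at `(0, 1)`, have no flux at all, and they add up to the integral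
of `u (1-u-v) f_u² + v (1-u-v) f_v² + u v (f_u - f_v)²`, so `∇f = 0`; then `p = b - f` gives `b = f`
on each edge (`eq_of_refMoment_eq_zero`). Finite-dimensional duality makes this quantitative
(`exists_refMoment_stability`). Transported by affine maps, it says that on a shape regular triangle
`T` the oscillation of `φ₀` and the jump `φ_b - φ₀` are bounded, in the maximum norm, by a multiple
of `K_T = ‖∇_d φ‖_{L²(T)}` (`exists_local_stability`).

*Globally*, take a point `x` of `Ω` at the height of no vertex, and the horizontal line through it.
Going left from triangle to triangle until an edge on `∂Ω` is met, where `φ_b = 0`, one finds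
`|φ₀(x)| ≤ C ∑ K_T`, the sum over the triangles that meet the line (`abs_v0_le_sum_crossing`). By
quasi-uniformity there are at most `C / h` of these (`card_crossing_le`), so
`φ₀(x)² ≤ C h⁻¹ ∑ K_T²`. On integrating over `Ω`, each `K_T²` is counted on a horizontal strip of
area at most `C h`, and the powers of `h` cancel (`sum_integral_sq_v0_le`).
-/

noncomputable section

namespace WeakGalerkin

/-! ### Radial polynomial fields -/

theorem at_mul (p q : Poly) (x : Plane) : Poly.at (p * q) x = p.at x * q.at x := by simp [Poly.at]
theorem at_add (p q : Poly) (x : Plane) : Poly.at (p + q) x = p.at x + q.at x := by simp [Poly.at]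
theorem at_sub (p q : Poly) (x : Plane) : Poly.at (p - q) x = p.at x - q.at x := by simp [Poly.at]
theorem at_smul (c : ℝ) (p : Poly) (x : Plane) : Poly.at (c • p) x = c * p.at x := by
  simp [Poly.at, MvPolynomial.smul_eval]

/-- The polynomial field `x ↦ p(x) (x - v)`. Its normal component vanishes on every line through
`v`, and on any other line it is a constant multiple of `p`. -/
def radial (v : Plane) (p : Poly) : PolyField :=
  fun k => p * (MvPolynomial.X k - MvPolynomial.C (v k))

/-- The derivative `(x - v) · ∇p` of `p` in the radial direction from `v`. -/
def radialDeriv (v : Plane) (p : Poly) : Poly :=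
  ∑ k, (MvPolynomial.X k - MvPolynomial.C (v k)) * MvPolynomial.pderiv k p

theorem radial_at (v : Plane) (p : Poly) (x : Plane) :
    (radial v p).at x = p.at x • (x - v) := by
  ext i; fin_cases i <;> simp [PolyField.at, Poly.at, radial]

theorem radial_div (v : Plane) (p : Poly) :
    (radial v p).div = 2 * p + radialDeriv v p := by
  simp [PolyField.div, radial, radialDeriv, Fin.sum_univ_two, Derivation.leibniz]
  ring

theorem radialDeriv_mul (v : Plane) (p q : Poly) :
    radialDeriv v (p * q) = p * radialDeriv v q + q * radialDeriv v p := by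
  simp [radialDeriv, Fin.sum_univ_two, Derivation.leibniz]
  ring

theorem radial_div_mul (v : Plane) (p q : Poly) :
    (radial v (p * q)).div = p * (radial v q).div + q * radialDeriv v p := by
  rw [radial_div, radial_div, radialDeriv_mul]
  ring

theorem sum_range_homogeneousComponent {p : Poly} {j : ℕ} (hp : p.totalDegree ≤ j) :
    ∑ i ∈ Finset.range (j + 1), MvPolynomial.homogeneousComponent i p = p := by
  conv_rhs => rw [← MvPolynomial.sum_homogeneousComponent p]
  symm
  refine Finset.sum_subset (Finset.range_subset_range.2 (by omega)) fun i _ hi => ?_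
  exact MvPolynomial.homogeneousComponent_eq_zero _ _ (by simpa using hi)

theorem radial_mem_RT (v : Plane) {p : Poly} {j : ℕ} (hp : p.totalDegree ≤ j) :
    radial v p ∈ RT j := by
  set r : Poly := ∑ i ∈ Finset.range j, MvPolynomial.homogeneousComponent i p with hr
  have hsum : r + MvPolynomial.homogeneousComponent j p = p := by
    rw [hr, ← Finset.sum_range_succ, sum_range_homogeneousComponent hp]
  have hdec : radial v p = (fun k => r * MvPolynomial.X k - p * MvPolynomial.C (v k)) +
      mulPosition (MvPolynomial.homogeneousComponent j p) := by
    funext k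
    simp only [radial, mulPosition, Pi.add_apply, LinearMap.pi_apply, LinearMap.mulRight_apply]
    conv_lhs => rw [mul_sub]
    nth_rewrite 1 [← hsum]
    ring
  rw [hdec]
  refine Submodule.add_mem_sup ?_ (Submodule.mem_map_of_mem
    (MvPolynomial.homogeneousComponent_mem _ _))
  refine Submodule.mem_pi.2 fun k _ => ?_
  rw [MvPolynomial.mem_restrictTotalDegree]
  refine (MvPolynomial.totalDegree_sub _ _).trans (max_le ?_ ?_)
  · rw [hr, Finset.sum_mul]
    refine MvPolynomial.totalDegree_finsetSum_le fun i hi => ?_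
    have h1 : (MvPolynomial.homogeneousComponent i p).totalDegree ≤ i :=
      (MvPolynomial.homogeneousComponent_isHomogeneous i p).totalDegree_le
    refine (MvPolynomial.totalDegree_mul _ _).trans ?_
    rw [MvPolynomial.totalDegree_X]
    have := Finset.mem_range.1 hi
    omega
  · refine (MvPolynomial.totalDegree_mul _ _).trans ?_
    simpa using hp

theorem coeff_X_mul_pderiv (k : Fin 2) (p : Poly) (m : Fin 2 →₀ ℕ) :
    MvPolynomial.coeff m (MvPolynomial.X k * MvPolynomial.pderiv k p) =
      m k * MvPolynomial.coeff m p := by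
  classical
  induction p using MvPolynomial.induction_on' with
  | monomial n r =>
    rw [MvPolynomial.X_mul_pderiv_monomial, MvPolynomial.coeff_smul]
    by_cases h : n = m
    · subst h; simp
    · simp [MvPolynomial.coeff_monomial, h]
  | add p q hp hq => simp [mul_add, hp, hq]

theorem totalDegree_X_mul_pderiv_le (k : Fin 2) (p : Poly) :
    (MvPolynomial.X k * MvPolynomial.pderiv k p).totalDegree ≤ p.totalDegree := by
  refine MvPolynomial.totalDegree_le_of_support_subset fun m hm => ?_
  rw [MvPolynomial.mem_support_iff, coeff_X_mul_pderiv] at hm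
  exact MvPolynomial.mem_support_iff.2 (right_ne_zero_of_mul hm)

theorem eq_C_of_pderiv_eq_zero {p : Poly} (h : ∀ k, MvPolynomial.pderiv k p = 0) :
    p = MvPolynomial.C (MvPolynomial.coeff 0 p) := by
  classical
  ext m
  rw [MvPolynomial.coeff_C]
  split_ifs with hm
  · rw [hm]
  · obtain ⟨k, hk⟩ : ∃ k, m k ≠ 0 := by
      by_contra! hc
      exact hm (Finsupp.ext fun i => (hc i).symm)
    have := coeff_X_mul_pderiv k p m
    rw [h k, mul_zero, MvPolynomial.coeff_zero] at this
    exact (mul_eq_zero.1 this.symm).resolve_left (by exact_mod_cast hk)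

/-! ### Integration over the reference triangle -/

/-- The closed triangle with vertices `(0,0)`, `(1,0)`, `(0,1)`. -/
def refTriangle : Set Plane := {x | 0 ≤ x 0 ∧ 0 ≤ x 1 ∧ x 0 + x 1 ≤ 1}

theorem isClosed_refTriangle : IsClosed refTriangle := by
  have h0 : Continuous fun x : Plane => x 0 := by fun_prop
  have h1 : Continuous fun x : Plane => x 1 := by fun_prop
  exact (isClosed_le continuous_const h0).inter ((isClosed_le continuous_const h1).inter
    (isClosed_le (h0.add h1) continuous_const))

theorem isCompact_refTriangle : IsCompact refTriangle := by
  refine Metric.isCompact_of_isClosed_isBounded isClosed_refTriangle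
    ((Metric.isBounded_closedBall (x := 0) (r := 2)).subset fun x hx => ?_)
  obtain ⟨h0, h1, h2⟩ := hx
  rw [mem_closedBall_zero_iff, EuclideanSpace.norm_eq, Fin.sum_univ_two]
  refine Real.sqrt_le_iff.2 ⟨by norm_num, ?_⟩
  simp only [Real.norm_eq_abs, sq_abs]
  nlinarith

theorem measurePreserving_pair :
    MeasurePreserving (fun z : ℝ × ℝ => (!₂[z.1, z.2] : Plane)) := by
  have h1 := (volume_preserving_finTwoArrow ℝ).symm
  have h2 := PiLp.volume_preserving_toLp (Fin 2)
  exact h2.comp h1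

theorem measurableEmbedding_pair :
    MeasurableEmbedding (fun z : ℝ × ℝ => (!₂[z.1, z.2] : Plane)) :=
  (MeasurableEquiv.toLp 2 (Fin 2 → ℝ)).measurableEmbedding.comp
    (MeasurableEquiv.finTwoArrow (α := ℝ)).symm.measurableEmbedding

theorem integral_refTriangle {F : Plane → ℝ} (hF : Continuous F) :
    (∫ x in refTriangle, F x = ∫ u in (0 : ℝ)..1, ∫ v in (0 : ℝ)..(1 - u), F !₂[u, v]) ∧
    (∫ x in refTriangle, F x = ∫ v in (0 : ℝ)..1, ∫ u in (0 : ℝ)..(1 - v), F !₂[u, v]) := by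
  have hint : IntegrableOn F refTriangle :=
    hF.continuousOn.integrableOn_compact isCompact_refTriangle
  have hI : Integrable (fun z : ℝ × ℝ => refTriangle.indicator F !₂[z.1, z.2])
      (volume.prod volume) :=
    (measurePreserving_pair.integrable_comp_emb measurableEmbedding_pair).2
      ((integrable_indicator_iff isClosed_refTriangle.measurableSet).2 hint)
  have h0 : ∫ x in refTriangle, F x =
      ∫ z : ℝ × ℝ, refTriangle.indicator F !₂[z.1, z.2] := by
    rw [← integral_indicator isClosed_refTriangle.measurableSet]
    exact (measurePreserving_pair.integral_comp measurableEmbedding_pair _).symm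
  have key : ∀ (f : ℝ → ℝ → ℝ) (g : ℝ → ℝ → ℝ),
      (∀ u v, g u v = if 0 ≤ u ∧ 0 ≤ v ∧ u + v ≤ 1 then f u v else 0) →
      ∫ u, ∫ v, g u v = ∫ u in (0 : ℝ)..1, ∫ v in (0 : ℝ)..(1 - u), f u v := by
    intro f g hg
    rw [intervalIntegral.integral_of_le zero_le_one, ← integral_Icc_eq_integral_Ioc,
      ← integral_indicator measurableSet_Icc]
    refine integral_congr_ae (Filter.Eventually.of_forall fun u => ?_)
    simp only [Set.indicator_apply, mem_Icc]
    split_ifs with hu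
    · rw [intervalIntegral.integral_of_le (by linarith [hu.2]), ← integral_Icc_eq_integral_Ioc,
        ← integral_indicator measurableSet_Icc]
      refine integral_congr_ae (Filter.Eventually.of_forall fun v => ?_)
      simp only [Set.indicator_apply, mem_Icc, hg]
      refine if_congr ?_ rfl rfl
      constructor
      · rintro ⟨-, h1, h2⟩; exact ⟨h1, by linarith⟩
      · rintro ⟨h1, h2⟩; exact ⟨hu.1, h1, by linarith⟩
    · have : ∀ v, g u v = 0 := fun v => by
        rw [hg, if_neg]
        rintro ⟨h1, h2, h3⟩
        exact hu ⟨h1, by linarith⟩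
      simp [this]
  constructor
  · rw [h0, Measure.volume_eq_prod, integral_prod _ hI]
    refine key _ _ fun u v => ?_
    simp [Set.indicator_apply, refTriangle]
  · rw [h0, Measure.volume_eq_prod, integral_prod_symm _ hI]
    refine key (fun v u => F !₂[u, v]) _ fun v u => ?_
    simp only [Set.indicator_apply, refTriangle, mem_ofPred_eq]
    refine if_congr ?_ rfl rfl
    simp only [Matrix.cons_val_zero, Matrix.cons_val_one]
    constructor
    · rintro ⟨h1, h2, h3⟩; exact ⟨h2, h1, by linarith⟩
    · rintro ⟨h1, h2, h3⟩; exact ⟨h2, h1, by linarith⟩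

/-- The chain rule for a polynomial along a plane curve. -/
theorem hasDerivAt_at_comp (p : Poly) {f g : ℝ → ℝ} {f' g' t : ℝ} (hf : HasDerivAt f f' t)
    (hg : HasDerivAt g g' t) :
    HasDerivAt (fun s => p.at !₂[f s, g s])
      (Poly.at (MvPolynomial.pderiv 0 p) !₂[f t, g t] * f' +
        Poly.at (MvPolynomial.pderiv 1 p) !₂[f t, g t] * g') t := by
  induction p using MvPolynomial.induction_on with
  | C a =>
    simp only [Poly.at, MvPolynomial.eval_C, MvPolynomial.pderiv_C, map_zero, zero_mul, add_zero]
    exact hasDerivAt_const t a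
  | add p q hp hq =>
    simp only [Poly.at, map_add] at hp hq ⊢
    exact (hp.fun_add hq).congr_deriv (by ring)
  | mul_X p i hp =>
    have hX : HasDerivAt (fun s => (!₂[f s, g s] : Plane) i) ((!₂[f', g'] : Plane) i) t := by
      fin_cases i
      · exact hf
      · exact hg
    simp only [Poly.at, map_mul, MvPolynomial.eval_X] at hp ⊢
    refine (hp.fun_mul hX).congr_deriv ?_
    fin_cases i <;> simp [Derivation.leibniz] <;> ring

theorem continuous_pair {f g : ℝ → ℝ} (hf : Continuous f) (hg : Continuous g) :
    Continuous fun s => (!₂[f s, g s] : Plane) := by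
  refine (PiLp.continuous_toLp 2 _).comp (continuous_pi fun i => ?_)
  fin_cases i
  · simpa using hf
  · simpa using hg

theorem integral_pderiv_fst (p : Poly) :
    ∫ x in refTriangle, Poly.at (MvPolynomial.pderiv 0 p) x =
      ∫ s in (0 : ℝ)..1, (p.at !₂[1 - s, s] - p.at !₂[0, s]) := by
  rw [(integral_refTriangle (continuous_at _)).2]
  refine intervalIntegral.integral_congr fun v _ => ?_
  exact intervalIntegral.integral_eq_sub_of_hasDerivAt (fun u _ => by
      simpa using hasDerivAt_at_comp p (hasDerivAt_id' u) (hasDerivAt_const u v))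
    (((continuous_at _).comp (continuous_pair continuous_id continuous_const)).intervalIntegrable
      _ _)

theorem integral_pderiv_snd (p : Poly) :
    ∫ x in refTriangle, Poly.at (MvPolynomial.pderiv 1 p) x =
      ∫ s in (0 : ℝ)..1, (p.at !₂[s, 1 - s] - p.at !₂[s, 0]) := by
  rw [(integral_refTriangle (continuous_at _)).1]
  refine intervalIntegral.integral_congr fun u _ => ?_
  exact intervalIntegral.integral_eq_sub_of_hasDerivAt (fun v _ => by
      simpa using hasDerivAt_at_comp p (hasDerivAt_const v u) (hasDerivAt_id' v))
    (((continuous_at _).comp (continuous_pair continuous_const continuous_id)).intervalIntegrable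
      _ _)

/-- The vertices of the reference triangle. -/
def refVertex : Fin 3 → Plane := ![!₂[0, 0], !₂[1, 0], !₂[0, 1]]

/-- The edge of the reference triangle opposite to its `i`-th vertex, parametrized by `[0, 1]`. -/
def refEdge (i : Fin 3) (s : ℝ) : Plane :=
  (![!₂[1 - s, s], !₂[0, s], !₂[s, 0]] : Fin 3 → Plane) i

theorem continuous_refEdge (i : Fin 3) : Continuous (refEdge i) := by
  fin_cases i
  · exact continuous_pair (by fun_prop) continuous_id
  · exact continuous_pair continuous_const continuous_id
  · exact continuous_pair continuous_id continuous_const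

theorem integrableOn_at_refTriangle (p : Poly) : IntegrableOn p.at refTriangle :=
  (continuous_at p).continuousOn.integrableOn_compact isCompact_refTriangle

theorem intervalIntegrable_at {f g : ℝ → ℝ} (hf : Continuous f) (hg : Continuous g) (p : Poly)
    (a b : ℝ) : IntervalIntegrable (fun s => p.at !₂[f s, g s]) volume a b :=
  ((continuous_at p).comp (continuous_pair hf hg)).intervalIntegrable _ _

/-- The divergence theorem for radial fields on the reference triangle: there is flux only through
the edge opposite to the centre. -/
theorem integral_radial_div (i : Fin 3) (p : Poly) :
    ∫ x in refTriangle, (radial (refVertex i) p).div.at x =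
      ∫ s in (0 : ℝ)..1, p.at (refEdge i s) := by
  have hA := integral_pderiv_fst p
  have hB := integral_pderiv_snd p
  have hA' := integral_pderiv_fst (MvPolynomial.X 0 * p)
  have hB' := integral_pderiv_snd (MvPolynomial.X 1 * p)
  have c1 : Continuous fun s : ℝ => 1 - s := by fun_prop
  have c2 : Continuous fun s : ℝ => s := by fun_prop
  have c3 : Continuous fun _ : ℝ => (0 : ℝ) := by fun_prop
  have hsym : ∀ g : ℝ → ℝ, ∫ s in (0 : ℝ)..1, g (1 - s) = ∫ s in (0 : ℝ)..1, g s := fun g => by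
    simp
  have h0 : ∫ x in refTriangle, (radial (refVertex 0) p).div.at x =
      ∫ s in (0 : ℝ)..1, p.at !₂[1 - s, s] := by
    have e : ∀ x, (radial (refVertex 0) p).div.at x =
        Poly.at (MvPolynomial.pderiv 0 (MvPolynomial.X 0 * p)) x +
        Poly.at (MvPolynomial.pderiv 1 (MvPolynomial.X 1 * p)) x := fun x => by
      simp [radial_div, radialDeriv, refVertex, Poly.at, Fin.sum_univ_two]; ring
    simp_rw [e]
    rw [integral_add (integrableOn_at_refTriangle _) (integrableOn_at_refTriangle _), hA', hB']
    rw [← hsym (fun s => Poly.at (MvPolynomial.X 1 * p) !₂[s, 1 - s] -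
        Poly.at (MvPolynomial.X 1 * p) !₂[s, 0]),
      ← intervalIntegral.integral_add]
    · refine intervalIntegral.integral_congr fun s _ => ?_
      simp [Poly.at]; ring
    · exact (intervalIntegrable_at c1 c2 _ _ _).sub (intervalIntegrable_at c3 c2 _ _ _)
    · simp only [sub_sub_cancel]
      exact (intervalIntegrable_at c1 c2 _ _ _).sub (intervalIntegrable_at c1 c3 _ _ _)
  fin_cases i
  · exact h0
  · have e : ∀ x, (radial (refVertex 1) p).div.at x =
        (radial (refVertex 0) p).div.at x - Poly.at (MvPolynomial.pderiv 0 p) x := fun x => by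
      simp [radial_div, radialDeriv, refVertex, Poly.at, Fin.sum_univ_two]; ring
    simp only [Fin.mk_one]
    simp_rw [e]
    rw [integral_sub (integrableOn_at_refTriangle _) (integrableOn_at_refTriangle _), hA, h0,
      intervalIntegral.integral_sub (intervalIntegrable_at c1 c2 _ _ _)
        (intervalIntegrable_at c3 c2 _ _ _)]
    simp [refEdge]
  · have e : ∀ x, (radial (refVertex 2) p).div.at x =
        (radial (refVertex 0) p).div.at x - Poly.at (MvPolynomial.pderiv 1 p) x := fun x => by
      simp [radial_div, radialDeriv, refVertex, Poly.at, Fin.sum_univ_two]; ring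
    simp only [Fin.reduceFinMk]
    simp_rw [e]
    rw [integral_sub (integrableOn_at_refTriangle _) (integrableOn_at_refTriangle _), hB, h0,
      intervalIntegral.integral_sub (intervalIntegrable_at c2 c1 _ _ _)
        (intervalIntegrable_at c2 c3 _ _ _), ← hsym (fun s => p.at !₂[s, 1 - s])]
    simp [refEdge]

/-! ### Stability of the discrete weak gradient on the reference triangle -/

/-- Finitely many functionals `L k` control, uniformly, a family of functionals `ℓ x` that is
pointwise bounded and vanishes on their common kernel. -/
theorem exists_bound_of_ker_le {W K X : Type*} [AddCommGroup W] [Module ℝ W] [Fintype K]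
    (L : K → W →ₗ[ℝ] ℝ) (ℓ : X → W →ₗ[ℝ] ℝ) (hker : ∀ w, (∀ k, L k w = 0) → ∀ x, ℓ x w = 0)
    (hbdd : ∀ w, ∃ M, ∀ x, |ℓ x w| ≤ M) :
    ∃ C, 0 < C ∧ ∀ w x, |ℓ x w| ≤ C * ∑ k, |L k w| := by
  classical
  let A : W →ₗ[ℝ] (K → ℝ) := LinearMap.pi L
  obtain ⟨s, hs⟩ := A.rangeRestrict.exists_rightInverse_of_surjective A.range_rangeRestrict
  obtain ⟨g, hg⟩ := s.exists_extend
  -- `g (A w)` differs from `w` by an element of the common kernel.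
  have hA : ∀ w, A (g (A w)) = A w := fun w => by
    have h1 : g (A w) = s (A.rangeRestrict w) := LinearMap.congr_fun hg (A.rangeRestrict w)
    have h2 := LinearMap.congr_fun hs (A.rangeRestrict w)
    rw [h1]
    exact congrArg Subtype.val h2
  choose M hM using fun k : K => hbdd (g (Pi.single k 1))
  refine ⟨1 + ∑ k, |M k|, by positivity, fun w x => ?_⟩
  have hw : ℓ x w = ℓ x (g (A w)) := by
    rw [← sub_eq_zero, ← map_sub]
    refine hker _ (fun k => ?_) x
    have := congrFun (hA w) k
    simp only [A, LinearMap.pi_apply] at this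
    rw [map_sub, sub_eq_zero]
    exact this.symm
  have hsum : A w = ∑ k, L k w • (Pi.single k 1 : K → ℝ) := by
    conv_lhs => rw [pi_eq_sum_univ' (A w)]
    exact Finset.sum_congr rfl fun k _ => rfl
  rw [hw, hsum, map_sum, map_sum, Finset.mul_sum]
  refine (Finset.abs_sum_le_sum_abs _ _).trans (Finset.sum_le_sum fun k _ => ?_)
  rw [map_smul, map_smul, smul_eq_mul, abs_mul, mul_comm]
  refine mul_le_mul_of_nonneg_right ?_ (abs_nonneg _)
  have h1 : |M k| ≤ ∑ k, |M k| := Finset.single_le_sum (f := fun k => |M k|)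
    (fun _ _ => abs_nonneg _) (Finset.mem_univ k)
  linarith [(hM k x).trans (le_abs_self _)]

/-- The right-hand side of the equation defining the discrete weak gradient, on the reference
triangle, for the function `{f, b}` and the test field `radial (refVertex i) p`. -/
def refMoment (i : Fin 3) (p f b : Poly) : ℝ :=
  -(∫ x in refTriangle, f.at x * (radial (refVertex i) p).div.at x) +
    ∫ s in (0 : ℝ)..1, b.at (refEdge i s) * p.at (refEdge i s)

theorem intervalIntegrable_refEdge (i : Fin 3) (p : Poly) :
    IntervalIntegrable (fun s => p.at (refEdge i s)) volume 0 1 :=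
  ((continuous_at p).comp (continuous_refEdge i)).intervalIntegrable _ _

/-- Integration by parts: the moment pairs the radial derivative of `f` on the triangle, and the
jump `b - f` on the edge, with `p`. -/
theorem refMoment_eq (i : Fin 3) (p f b : Poly) :
    refMoment i p f b = (∫ x in refTriangle, p.at x * (radialDeriv (refVertex i) f).at x) +
      ∫ s in (0 : ℝ)..1, Poly.at ((b - f) * p) (refEdge i s) := by
  have h := integral_radial_div i (f * p)
  have e : ∀ x, (radial (refVertex i) (f * p)).div.at x =
      Poly.at (f * (radial (refVertex i) p).div) x +
        Poly.at (p * radialDeriv (refVertex i) f) x := fun x => by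
    rw [radial_div_mul, at_add]
  simp_rw [e] at h
  rw [integral_add (integrableOn_at_refTriangle _) (integrableOn_at_refTriangle _)] at h
  have e2 : ∀ x, Poly.at ((b - f) * p) x = Poly.at (b * p) x - Poly.at (f * p) x := fun x => by
    rw [← at_sub, sub_mul]
  simp_rw [e2]
  rw [intervalIntegral.integral_sub (intervalIntegrable_refEdge _ _)
    (intervalIntegrable_refEdge _ _), ← h, refMoment]
  simp_rw [at_mul]
  ring

/-- If all moments of `{f, b}` vanish, then `f` is constant and equal to `b` on the edges. -/
theorem eq_of_refMoment_eq_zero {j : ℕ} {f : Poly} {b : Fin 3 → Poly} (hf : f.totalDegree ≤ j)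
    (hb : ∀ i, (b i).totalDegree ≤ j)
    (h : ∀ i, ∀ p : Poly, p.totalDegree ≤ j → refMoment i p f (b i) = 0) :
    (∀ x y, f.at x = f.at y) ∧ ∀ i, ∀ s ∈ Icc (0 : ℝ) 1, (b i).at (refEdge i s) =
      f.at (refEdge i s) := by
  have hd : ∀ k, MvPolynomial.pderiv k f = 0 := by
    -- These two test fields have no flux through the boundary, so only `∇f` is seen.
    have h1 := h 1 (-(MvPolynomial.X 0 * MvPolynomial.pderiv 0 f))
      ((MvPolynomial.totalDegree_neg _).trans_le ((totalDegree_X_mul_pderiv_le 0 f).trans hf))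
    have h2 := h 2 (-(MvPolynomial.X 1 * MvPolynomial.pderiv 1 f))
      ((MvPolynomial.totalDegree_neg _).trans_le ((totalDegree_X_mul_pderiv_le 1 f).trans hf))
    rw [refMoment_eq] at h1 h2
    have z1 : ∀ s, Poly.at ((b 1 - f) * -(MvPolynomial.X 0 * MvPolynomial.pderiv 0 f))
        (refEdge 1 s) = 0 := fun s => by simp [Poly.at, refEdge]
    have z2 : ∀ s, Poly.at ((b 2 - f) * -(MvPolynomial.X 1 * MvPolynomial.pderiv 1 f))
        (refEdge 2 s) = 0 := fun s => by simp [Poly.at, refEdge]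
    simp_rw [z1] at h1
    simp_rw [z2] at h2
    simp_rw [← at_mul] at h1 h2
    have h3 := congrArg₂ (· + ·) h1 h2
    simp only [intervalIntegral.integral_zero, add_zero] at h3
    rw [← integral_add (integrableOn_at_refTriangle _) (integrableOn_at_refTriangle _)] at h3
    set g0 : Plane → ℝ := fun x => Poly.at (MvPolynomial.pderiv 0 f) x with hg0
    set g1 : Plane → ℝ := fun x => Poly.at (MvPolynomial.pderiv 1 f) x with hg1
    have c0 : Continuous g0 := continuous_at _
    have c1 : Continuous g1 := continuous_at _
    set F : Plane → ℝ := fun x => x 0 * (1 - x 0 - x 1) * g0 x ^ 2 +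
      x 1 * (1 - x 0 - x 1) * g1 x ^ 2 + x 0 * x 1 * (g0 x - g1 x) ^ 2 with hF
    have hFc : Continuous F := by fun_prop
    have h4 : ∫ x in refTriangle, F x = 0 := by
      rw [← h3]
      refine integral_congr_ae (Filter.Eventually.of_forall fun x => ?_)
      simp [hF, hg0, hg1, Poly.at, radialDeriv, refVertex, Fin.sum_univ_two]
      ring
    have hFnn : ∀ x ∈ refTriangle, 0 ≤ F x := fun x ⟨hx0, hx1, hx2⟩ => by
      have : 0 ≤ 1 - x 0 - x 1 := by linarith
      simp only [hF]
      positivity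
    let U : Set Plane := {x | 0 < x 0 ∧ 0 < x 1 ∧ x 0 + x 1 < 1}
    have hU : IsOpen U := by
      have k0 : Continuous fun x : Plane => x 0 := by fun_prop
      have k1 : Continuous fun x : Plane => x 1 := by fun_prop
      exact (isOpen_lt continuous_const k0).inter ((isOpen_lt continuous_const k1).inter
        (isOpen_lt (k0.add k1) continuous_const))
    have hUR : U ⊆ refTriangle := fun x ⟨a, b, c⟩ => ⟨a.le, b.le, c.le⟩
    have hUne : U.Nonempty := ⟨!₂[1 / 3, 1 / 3], by norm_num [U]⟩
    have hF0 : ∀ x ∈ U, F x = 0 := by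
      have hae := (setIntegral_eq_zero_iff_of_nonneg_ae
        ((ae_restrict_iff' isClosed_refTriangle.measurableSet).2
          (Filter.Eventually.of_forall hFnn))
        (hFc.continuousOn.integrableOn_compact isCompact_refTriangle)).1 h4
      exact Measure.eqOn_open_of_ae_eq (ae_restrict_of_ae_restrict_of_subset (μ := volume) hUR hae)
        hU hFc.continuousOn continuousOn_const
    have hg : ∀ x ∈ U, g0 x = 0 ∧ g1 x = 0 := fun x hx => by
      have hx' := hF0 x hx
      obtain ⟨hx0, hx1, hx2⟩ := hx
      have hx3 : 0 < 1 - x 0 - x 1 := by linarith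
      simp only [hF] at hx'
      have n1 : 0 ≤ x 0 * (1 - x 0 - x 1) * g0 x ^ 2 := by positivity
      have n2 : 0 ≤ x 1 * (1 - x 0 - x 1) * g1 x ^ 2 := by positivity
      have n3 : 0 ≤ x 0 * x 1 * (g0 x - g1 x) ^ 2 := by positivity
      have e1 : x 0 * (1 - x 0 - x 1) * g0 x ^ 2 = 0 := by linarith
      have e2 : x 1 * (1 - x 0 - x 1) * g1 x ^ 2 = 0 := by linarith
      exact ⟨by simpa [hx0.ne', hx3.ne'] using e1, by simpa [hx1.ne', hx3.ne'] using e2⟩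
    intro k
    refine poly_eq_zero hU hUne fun x hx => ?_
    fin_cases k
    · exact (hg x hx).1
    · exact (hg x hx).2
  constructor
  · intro x y
    rw [eq_C_of_pderiv_eq_zero hd]
    simp [Poly.at]
  · intro i
    have h1 := h i (b i - f) ((MvPolynomial.totalDegree_sub _ _).trans (max_le (hb i) hf))
    have hr : radialDeriv (refVertex i) f = 0 := by simp [radialDeriv, hd]
    rw [refMoment_eq, hr] at h1
    have hc : Continuous fun s => Poly.at ((b i - f) * (b i - f)) (refEdge i s) :=
      (continuous_at _).comp (continuous_refEdge i)
    have hz : ∫ s in (0 : ℝ)..1, Poly.at ((b i - f) * (b i - f)) (refEdge i s) = 0 := by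
      simpa [Poly.at] using h1
    intro s hs
    by_contra hne
    refine (intervalIntegral.integral_pos zero_lt_one hc.continuousOn (fun t _ => ?_)
      ⟨s, hs, ?_⟩).ne' hz
    · rw [at_mul]; exact mul_self_nonneg _
    · rw [at_mul, at_sub]
      exact mul_self_pos.2 (sub_ne_zero.2 hne)

theorem exists_abs_at_le (p : Poly) : ∃ M, ∀ x ∈ refTriangle, |p.at x| ≤ M := by
  obtain ⟨M, hM⟩ :=
    isCompact_refTriangle.exists_bound_of_continuousOn (continuous_at p).continuousOn
  exact ⟨M, hM⟩

theorem refEdge_mem (i : Fin 3) {s : ℝ} (hs : s ∈ Icc (0 : ℝ) 1) : refEdge i s ∈ refTriangle := by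
  have h0 := hs.1
  have h1 := hs.2
  fin_cases i <;> simp [refEdge, refTriangle] <;> (try constructor) <;> linarith

/-- The moments as functionals of `{f, b}`. -/
def refMomentLinear (j : ℕ) (i : Fin 3) (p : Poly) :
    (MvPolynomial.restrictTotalDegree (Fin 2) ℝ j ×
      (Fin 3 → MvPolynomial.restrictTotalDegree (Fin 2) ℝ j)) →ₗ[ℝ] ℝ where
  toFun w := refMoment i p w.1.1 (w.2 i).1
  map_add' w w' := by
    simp only [refMoment, Prod.fst_add, Prod.snd_add, Pi.add_apply, Submodule.coe_add,
      ← at_mul, add_mul]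
    simp_rw [at_add]
    rw [integral_add (integrableOn_at_refTriangle _) (integrableOn_at_refTriangle _),
      intervalIntegral.integral_add (intervalIntegrable_refEdge _ _)
        (intervalIntegrable_refEdge _ _)]
    ring
  map_smul' c w := by
    simp only [refMoment, Prod.smul_fst, Prod.smul_snd, Pi.smul_apply, Submodule.coe_smul,
      at_smul, mul_assoc, integral_const_mul, intervalIntegral.integral_const_mul, smul_eq_mul,
      RingHom.id_apply]
    ring

theorem refMoment_smul (c : ℝ) (i : Fin 3) (p f b : Poly) :
    refMoment i (c • p) f b = c * refMoment i p f b := by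
  have h : radial (refVertex i) (c • p) = c • radial (refVertex i) p := by
    funext k; simp [radial]
  simp only [refMoment, h, div_smul_at, at_smul, mul_left_comm _ c, integral_const_mul,
    intervalIntegral.integral_const_mul]
  ring

theorem refMoment_add (i : Fin 3) (p q f b : Poly) :
    refMoment i (p + q) f b = refMoment i p f b + refMoment i q f b := by
  simp only [refMoment_eq, ← at_mul, add_mul, mul_add]
  simp_rw [at_add]
  rw [integral_add (integrableOn_at_refTriangle _) (integrableOn_at_refTriangle _),
    intervalIntegral.integral_add (intervalIntegrable_refEdge _ _)
      (intervalIntegrable_refEdge _ _)]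
  ring

/-- The moments of `{f, b}` control the oscillation of `f` and the jumps `b - f` in the maximum
norm, with a constant that depends on the degree only. -/
theorem exists_refMoment_stability (j : ℕ) :
    ∃ C : ℝ, 0 < C ∧ ∀ (f : Poly) (b : Fin 3 → Poly) (δ : ℝ), f.totalDegree ≤ j →
      (∀ i, (b i).totalDegree ≤ j) →
      (∀ i, ∀ p : Poly, p.totalDegree ≤ j → (∀ x ∈ refTriangle, |p.at x| ≤ 1) →
        |refMoment i p f (b i)| ≤ δ) →
      (∀ x ∈ refTriangle, ∀ y ∈ refTriangle, |f.at x - f.at y| ≤ C * δ) ∧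
      ∀ i, ∀ s ∈ Icc (0 : ℝ) 1, |(b i).at (refEdge i s) - f.at (refEdge i s)| ≤ C * δ := by
  let P := MvPolynomial.restrictTotalDegree (Fin 2) ℝ j
  let e := Module.finBasis ℝ P
  have hP : ∀ p : P, p.1.totalDegree ≤ j := fun p =>
    (MvPolynomial.mem_restrictTotalDegree _ _ _).1 p.2
  let L : Fin 3 × Fin (Module.finrank ℝ P) → (P × (Fin 3 → P)) →ₗ[ℝ] ℝ :=
    fun k => refMomentLinear j k.1 (e k.2).1
  let ev : Plane → P →ₗ[ℝ] ℝ := fun x =>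
    { toFun := fun p => Poly.at p.1 x
      map_add' := fun p q => at_add _ _ _
      map_smul' := fun c p => at_smul _ _ _ }
  have hev : ∀ x (p : P), ev x p = Poly.at p.1 x := fun _ _ => rfl
  let ℓ : (refTriangle × refTriangle) ⊕ (Fin 3 × Icc (0 : ℝ) 1) → (P × (Fin 3 → P)) →ₗ[ℝ] ℝ :=
    Sum.elim (fun z => (ev z.1 - ev z.2) ∘ₗ LinearMap.fst _ _ _)
      (fun z => ev (refEdge z.1 z.2) ∘ₗ LinearMap.proj z.1 ∘ₗ LinearMap.snd _ _ _ -
        ev (refEdge z.1 z.2) ∘ₗ LinearMap.fst _ _ _)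
  obtain ⟨C, hC, hCb⟩ := exists_bound_of_ker_le L ℓ
    (fun w hw => by
      have hmom : ∀ i, ∀ p : Poly, p.totalDegree ≤ j → refMoment i p w.1.1 (w.2 i).1 = 0 := by
        intro i p hp
        have hlin : ∀ p : P, refMoment i p.1 w.1.1 (w.2 i).1 = 0 := by
          intro p
          let M : P →ₗ[ℝ] ℝ :=
            { toFun := fun p => refMoment i p.1 w.1.1 (w.2 i).1
              map_add' := fun p q => refMoment_add _ _ _ _ _
              map_smul' := fun c p => refMoment_smul _ _ _ _ _ }
          have hM : M = 0 := e.ext fun k => hw (i, k)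
          exact LinearMap.congr_fun hM p
        exact hlin ⟨p, (MvPolynomial.mem_restrictTotalDegree _ _ _).2 hp⟩
      obtain ⟨h1, h2⟩ := eq_of_refMoment_eq_zero (hP w.1) (fun i => hP (w.2 i)) hmom
      rintro (⟨x, y⟩ | ⟨i, s⟩)
      · exact sub_eq_zero.2 (h1 x y)
      · exact sub_eq_zero.2 (h2 i s s.2))
    (fun w => by
      obtain ⟨M, hM⟩ := exists_abs_at_le w.1.1
      choose N hN using fun i => exists_abs_at_le (w.2 i).1
      refine ⟨2 * |M| + ∑ i, |N i|, ?_⟩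
      have hsum : 0 ≤ ∑ i, |N i| := Finset.sum_nonneg fun _ _ => abs_nonneg _
      have hM' : ∀ x ∈ refTriangle, |Poly.at w.1.1 x| ≤ |M| := fun x hx =>
        (hM x hx).trans (le_abs_self _)
      rintro (⟨x, y⟩ | ⟨i, s⟩)
      · refine (abs_sub (Poly.at w.1.1 x) (Poly.at w.1.1 y)).trans ?_
        linarith [hM' x x.2, hM' y y.2]
      · refine (abs_sub (Poly.at (w.2 i).1 (refEdge i s)) (Poly.at w.1.1 (refEdge i s))).trans ?_
        have h1 := hM' _ (refEdge_mem i s.2)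
        have h2 := (hN i _ (refEdge_mem i s.2)).trans (le_abs_self _)
        have h3 : |N i| ≤ ∑ i, |N i| := Finset.single_le_sum (f := fun i => |N i|)
          (fun _ _ => abs_nonneg _) (Finset.mem_univ i)
        linarith [abs_nonneg M])
  choose N hN using fun k => exists_abs_at_le (e k).1
  refine ⟨C * (1 + ∑ k : Fin 3 × Fin (Module.finrank ℝ P), (1 + |N k.2|)), by positivity,
    fun f b δ hf hb hδ => ?_⟩
  have hδ0 : 0 ≤ δ := (abs_nonneg _).trans (hδ 0 0 (by simp) (by simp [Poly.at]))
  let w : P × (Fin 3 → P) := (⟨f, (MvPolynomial.mem_restrictTotalDegree _ _ _).2 hf⟩,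
    fun i => ⟨b i, (MvPolynomial.mem_restrictTotalDegree _ _ _).2 (hb i)⟩)
  have hL : ∀ k, |L k w| ≤ (1 + |N k.2|) * δ := by
    intro k
    have hpos : 0 < 1 + |N k.2| := by positivity
    have h1 := hδ k.1 ((1 + |N k.2|)⁻¹ • (e k.2).1)
      ((MvPolynomial.totalDegree_smul_le _ _).trans (hP _)) (fun x hx => by
        rw [at_smul, abs_mul, abs_of_pos (inv_pos.2 hpos), inv_mul_le_iff₀ hpos]
        linarith [hN k.2 x hx, le_abs_self (N k.2)])
    rw [refMoment_smul, abs_mul, abs_of_pos (inv_pos.2 hpos), inv_mul_le_iff₀ hpos] at h1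
    exact h1
  have hfin : ∀ x, |ℓ x w| ≤
      C * (1 + ∑ k : Fin 3 × Fin (Module.finrank ℝ P), (1 + |N k.2|)) * δ := by
    intro x
    refine (hCb w x).trans ?_
    rw [mul_assoc]
    refine mul_le_mul_of_nonneg_left ?_ hC.le
    refine (Finset.sum_le_sum fun k _ => hL k).trans ?_
    rw [← Finset.sum_mul]
    exact mul_le_mul_of_nonneg_right (by linarith) hδ0
  exact ⟨fun x hx y hy => hfin (Sum.inl (⟨x, hx⟩, ⟨y, hy⟩)),
    fun i s hs => hfin (Sum.inr (i, ⟨s, hs⟩))⟩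

/-! ### Affine maps from the reference triangle -/

/-- The determinant of two vectors of the plane. -/
def cross (u w : Plane) : ℝ := u 0 * w 1 - u 1 * w 0

/-- The determinant of the linear part of `refMap a`: twice the signed area of the triangle with
vertices `a`. -/
def jac (a : Fin 3 → Plane) : ℝ := cross (a 1 - a 0) (a 2 - a 0)

/-- The linear part of `refMap a`. -/
def refLinear (a : Fin 3 → Plane) : Plane →ₗ[ℝ] Plane :=
  Matrix.toLin (EuclideanSpace.basisFun (Fin 2) ℝ).toBasis
    (EuclideanSpace.basisFun (Fin 2) ℝ).toBasis
    !![(a 1 - a 0) 0, (a 2 - a 0) 0; (a 1 - a 0) 1, (a 2 - a 0) 1]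

/-- The affine map that sends the vertices of the reference triangle to `a 0`, `a 1`, `a 2`. -/
def refMap (a : Fin 3 → Plane) (x : Plane) : Plane := a 0 + refLinear a x

theorem det_refLinear (a : Fin 3 → Plane) : LinearMap.det (refLinear a) = jac a := by
  rw [refLinear, LinearMap.det_toLin, Matrix.det_fin_two_of, jac, cross]
  ring

theorem refLinear_apply (a : Fin 3 → Plane) (x : Plane) :
    refLinear a x = x 0 • (a 1 - a 0) + x 1 • (a 2 - a 0) := by
  ext k
  fin_cases k <;>
    simp [refLinear, Matrix.toLin_apply, Fin.sum_univ_two, Matrix.mulVec, dotProduct] <;> ring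

theorem refMap_apply (a : Fin 3 → Plane) (x : Plane) :
    refMap a x = a 0 + (x 0 • (a 1 - a 0) + x 1 • (a 2 - a 0)) := by
  rw [refMap, refLinear_apply]

theorem refMap_eq (a : Fin 3 → Plane) (x : Plane) :
    refMap a x = (1 - x 0 - x 1) • a 0 + x 0 • a 1 + x 1 • a 2 := by
  rw [refMap_apply]; module

theorem image_refMap (a : Fin 3 → Plane) :
    refMap a '' refTriangle = convexHull ℝ (range a) := by
  have hconv : Convex ℝ refTriangle := by
    rintro x ⟨x0, x1, x2⟩ y ⟨y0, y1, y2⟩ s t hs ht hst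
    refine ⟨?_, ?_, ?_⟩ <;> simp only [PiLp.add_apply, PiLp.smul_apply, smul_eq_mul]
    · positivity
    · positivity
    · nlinarith [mul_le_mul_of_nonneg_left x2 hs, mul_le_mul_of_nonneg_left y2 ht]
  apply Subset.antisymm
  · rintro _ ⟨x, ⟨h0, h1, h2⟩, rfl⟩
    have hm : ∀ i, a i ∈ convexHull ℝ (range a) := fun i => subset_convexHull _ _ ⟨i, rfl⟩
    have := (convex_convexHull ℝ (range a)).sum_mem (t := Finset.univ)
      (w := ![1 - x 0 - x 1, x 0, x 1]) (z := a)
      (fun i _ => by fin_cases i <;> simp <;> linarith) (by simp [Fin.sum_univ_three]; ring)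
      (fun i _ => hm i)
    rw [refMap_eq]
    simpa [Fin.sum_univ_three] using this
  · refine convexHull_min ?_ ?_
    · rintro _ ⟨i, rfl⟩
      fin_cases i
      · exact ⟨!₂[0, 0], by norm_num [refTriangle], by simp [refMap_eq]⟩
      · exact ⟨!₂[1, 0], by norm_num [refTriangle], by simp [refMap_eq]⟩
      · exact ⟨!₂[0, 1], by norm_num [refTriangle], by simp [refMap_eq]⟩
    · have h1 := (hconv.linear_image (refLinear a)).translate (a 0)
      rwa [image_image] at h1

theorem refMap_injective {a : Fin 3 → Plane} (ha : jac a ≠ 0) : Function.Injective (refMap a) := by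
  have hinj : Function.Injective (refLinear a) :=
    ((Module.End.isUnit_iff _).1 ((LinearMap.isUnit_iff_isUnit_det _).2
      (by rw [det_refLinear]; exact ha.isUnit))).injective
  exact fun x y hxy => hinj (add_left_cancel hxy)

theorem integral_convexHull {a : Fin 3 → Plane} (ha : jac a ≠ 0) (F : Plane → ℝ) :
    ∫ x in convexHull ℝ (range a), F x = |jac a| * ∫ x in refTriangle, F (refMap a x) := by
  have hd : ∀ x ∈ refTriangle, HasFDerivWithinAt (refMap a)
      (LinearMap.toContinuousLinearMap (refLinear a)) refTriangle x := fun x _ =>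
    ((LinearMap.toContinuousLinearMap (refLinear a)).hasFDerivAt.const_add (a 0)).hasFDerivWithinAt
  rw [← image_refMap, integral_image_eq_integral_abs_det_fderiv_smul volume
    isClosed_refTriangle.measurableSet hd (refMap_injective ha).injOn]
  have : (LinearMap.toContinuousLinearMap (refLinear a)).det = jac a := by
    rw [← det_refLinear]; rfl
  simp [this, integral_const_mul]

theorem volume_convexHull {a : Fin 3 → Plane} :
    volume (convexHull ℝ (range a)) = ENNReal.ofReal |jac a| * volume refTriangle := by
  rw [← image_refMap, ← det_refLinear, ← Measure.addHaar_image_linearMap]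
  have : refMap a '' refTriangle = (fun y => a 0 + y) '' (refLinear a '' refTriangle) := by
    rw [image_image]; rfl
  rw [this, image_add_left, measure_preimage_add]

theorem volume_real_refTriangle : volume.real refTriangle = 1 / 2 := by
  have h := (integral_refTriangle (F := fun _ => 1) continuous_const).1
  simp only [integral_const, MeasurableSet.univ, measureReal_restrict_apply, univ_inter,
    smul_eq_mul, mul_one, intervalIntegral.integral_const, sub_zero] at h
  rw [h, intervalIntegral.integral_sub (by simp) (by simp)]
  norm_num

/-! ### Polynomials under affine maps -/

theorem bind₁_at (f : Fin 2 → Poly) (p : Poly) (x : Plane) :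
    Poly.at (MvPolynomial.bind₁ f p) x = p.at !₂[(f 0).at x, (f 1).at x] := by
  induction p using MvPolynomial.induction_on with
  | C c => simp [Poly.at]
  | add p q hp hq => rw [map_add, at_add, hp, hq, at_add]
  | mul_X p k hp =>
    rw [map_mul, at_mul, hp, at_mul]
    congr 1
    fin_cases k <;> simp [Poly.at]

theorem totalDegree_bind₁_le {f : Fin 2 → Poly} (hf : ∀ k, (f k).totalDegree ≤ 1) (p : Poly) :
    MvPolynomial.totalDegree (MvPolynomial.bind₁ f p) ≤ p.totalDegree := by
  rw [MvPolynomial.bind₁, MvPolynomial.aeval_def, MvPolynomial.eval₂_eq']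
  refine MvPolynomial.totalDegree_finsetSum_le fun m hm => ?_
  refine (MvPolynomial.totalDegree_mul _ _).trans ?_
  rw [MvPolynomial.algebraMap_eq, MvPolynomial.totalDegree_C, zero_add]
  refine (MvPolynomial.totalDegree_finsetProd _ _).trans ?_
  refine (Finset.sum_le_sum fun k _ => (MvPolynomial.totalDegree_pow _ _).trans
    (Nat.mul_le_mul_left _ (hf k))).trans ?_
  have := MvPolynomial.le_totalDegree hm
  rw [Finsupp.sum_fintype _ _ (fun _ => rfl)] at this
  simpa using this

theorem eq_of_at_eq {p q : Poly} (h : ∀ x, p.at x = q.at x) : p = q :=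
  MvPolynomial.funext fun x => by simpa [Poly.at] using h (WithLp.toLp 2 x)

theorem totalDegree_affine_le (c₀ c₁ c₂ : ℝ) :
    (MvPolynomial.C c₀ + (MvPolynomial.C c₁ * MvPolynomial.X 0 +
      MvPolynomial.C c₂ * MvPolynomial.X 1) : Poly).totalDegree ≤ 1 := by
  have h : ∀ (c : ℝ) (k : Fin 2),
      (MvPolynomial.C c * MvPolynomial.X k : Poly).totalDegree ≤ 1 := fun c k =>
    (MvPolynomial.totalDegree_mul _ _).trans (by simp)
  refine (MvPolynomial.totalDegree_add _ _).trans (max_le (by simp) ?_)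
  exact (MvPolynomial.totalDegree_add _ _).trans (max_le (h _ _) (h _ _))

/-- The composition `p ∘ refMap a` as a polynomial. -/
def pullback (a : Fin 3 → Plane) (p : Poly) : Poly :=
  MvPolynomial.bind₁ (fun k => MvPolynomial.C (a 0 k) +
    (MvPolynomial.C ((a 1 - a 0) k) * MvPolynomial.X 0 +
      MvPolynomial.C ((a 2 - a 0) k) * MvPolynomial.X 1)) p

theorem pullback_at (a : Fin 3 → Plane) (p : Poly) (x : Plane) :
    (pullback a p).at x = p.at (refMap a x) := by
  rw [pullback, bind₁_at]
  congr 1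
  ext k
  fin_cases k <;> simp [Poly.at, refMap_apply] <;> ring

theorem totalDegree_pullback_le (a : Fin 3 → Plane) (p : Poly) :
    (pullback a p).totalDegree ≤ p.totalDegree :=
  totalDegree_bind₁_le (fun _ => totalDegree_affine_le _ _ _) p

theorem exists_pullback_eq {a : Fin 3 → Plane} (ha : jac a ≠ 0) (p : Poly) :
    ∃ q : Poly, q.totalDegree ≤ p.totalDegree ∧ pullback a q = p := by
  set u := a 1 - a 0 with hu
  set w := a 2 - a 0 with hw
  have hJ : jac a = u 0 * w 1 - u 1 * w 0 := rfl
  -- Cramer's rule for the inverse of the affine map.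
  refine ⟨MvPolynomial.bind₁ ![
    MvPolynomial.C ((a 0 1 * w 0 - a 0 0 * w 1) / jac a) +
      (MvPolynomial.C (w 1 / jac a) * MvPolynomial.X 0 +
        MvPolynomial.C (-w 0 / jac a) * MvPolynomial.X 1),
    MvPolynomial.C ((a 0 0 * u 1 - a 0 1 * u 0) / jac a) +
      (MvPolynomial.C (-u 1 / jac a) * MvPolynomial.X 0 +
        MvPolynomial.C (u 0 / jac a) * MvPolynomial.X 1)] p,
    totalDegree_bind₁_le (fun k => ?_) p, eq_of_at_eq fun x => ?_⟩
  · fin_cases k <;> exact totalDegree_affine_le _ _ _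
  · rw [pullback_at, bind₁_at]
    congr 1
    ext k
    fin_cases k <;> simp [Poly.at, refMap_apply, ← hu, ← hw] <;> field_simp <;> rw [hJ] <;> ring

theorem refMap_refVertex (a : Fin 3 → Plane) (i : Fin 3) : refMap a (refVertex i) = a i := by
  rw [refMap_apply]
  fin_cases i <;> simp [refVertex]

/-- Affine maps send radial derivatives to radial derivatives. -/
theorem pullback_radialDeriv (a : Fin 3 → Plane) (i : Fin 3) (p : Poly) (x : Plane) :
    (radialDeriv (a i) p).at (refMap a x) = (radialDeriv (refVertex i) (pullback a p)).at x := by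
  induction p using MvPolynomial.induction_on with
  | C c => simp [radialDeriv, pullback, Poly.at]
  | add p q hp hq =>
    have h : ∀ (v : Plane) (p q : Poly),
        radialDeriv v (p + q) = radialDeriv v p + radialDeriv v q :=
      fun v p q => by
        simp only [radialDeriv, map_add, mul_add, Finset.sum_add_distrib]
    have h' : pullback a (p + q) = pullback a p + pullback a q := map_add _ _ _
    rw [h', h, h, at_add, at_add, hp, hq]
  | mul_X p k hp =>
    have h' : pullback a (p * MvPolynomial.X k) = pullback a p * pullback a (MvPolynomial.X k) :=
      map_mul _ _ _
    rw [h', radialDeriv_mul, radialDeriv_mul, at_add, at_add, at_mul, at_mul, at_mul, at_mul, hp,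
      pullback_at, pullback_at]
    have hX : ∀ (v y : Plane), Poly.at (radialDeriv v (MvPolynomial.X k)) y = y k - v k := by
      intro v y
      fin_cases k <;> simp [radialDeriv, Poly.at, Fin.sum_univ_two]
    have hL : ∀ v : Plane, (radialDeriv v (pullback a (MvPolynomial.X k))).at x =
        (a 1 - a 0) k * (x 0 - v 0) + (a 2 - a 0) k * (x 1 - v 1) := by
      intro v
      rw [pullback, MvPolynomial.bind₁_X_right]
      generalize (a 1 - a 0) k = c₁
      generalize (a 2 - a 0) k = c₂
      simp [radialDeriv, Poly.at, Fin.sum_univ_two]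
      ring
    rw [hX, hL, ← refMap_refVertex a i, refMap_apply, refMap_apply]
    simp only [PiLp.add_apply, PiLp.smul_apply, smul_eq_mul]
    ring

theorem pullback_radial_div (a : Fin 3 → Plane) (i : Fin 3) (p : Poly) (x : Plane) :
    (radial (a i) p).div.at (refMap a x) = (radial (refVertex i) (pullback a p)).div.at x := by
  rw [radial_div, radial_div, at_add, at_add, pullback_radialDeriv, at_mul, at_mul, pullback_at]
  simp [Poly.at]

/-! ### Edges and normals -/

/-- Arc length integrals over a segment in terms of the affine parametrization. -/
theorem integral_segment {b c : Plane} (hbc : b ≠ c) (F : Plane → ℝ) :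
    ∫ x in segment ℝ b c, F x ∂(Measure.hausdorffMeasure 1) =
      ‖c - b‖ * ∫ s in (0 : ℝ)..1, F (b + s • (c - b)) := by
  set l := ‖c - b‖ with hl
  have hl0 : 0 < l := norm_pos_iff.2 (sub_ne_zero.2 hbc.symm)
  let g : ℝ → Plane := fun t => b + t • (l⁻¹ • (c - b))
  have hu : ‖l⁻¹ • (c - b)‖ = 1 := by
    rw [norm_smul, norm_inv, norm_norm, ← hl, inv_mul_cancel₀ hl0.ne']
  have hg : Isometry g := Isometry.of_dist_eq fun s t => by
    rw [dist_add_left, dist_eq_norm, dist_eq_norm, ← sub_smul, norm_smul, hu, mul_one]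
  have hgl : ∀ s, g (l * s) = b + s • (c - b) := fun s => by
    simp only [g, smul_smul]
    congr 2
    field_simp
  have hseg : segment ℝ b c = g '' Icc 0 l := by
    rw [segment_eq_image']
    ext x
    constructor
    · rintro ⟨s, ⟨hs0, hs1⟩, rfl⟩
      exact ⟨l * s, ⟨by positivity, by nlinarith⟩, hgl s⟩
    · rintro ⟨t, ⟨ht0, ht1⟩, rfl⟩
      refine ⟨t / l, ⟨by positivity, (div_le_one hl0).2 ht1⟩, ?_⟩
      simp only
      rw [← hgl, mul_div_cancel₀ _ hl0.ne']
  have hmap := hg.map_hausdorffMeasure (d := 1) (Or.inl zero_le_one)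
  have hemb : MeasurableEmbedding g := hg.isClosedEmbedding.measurableEmbedding
  have hsub : segment ℝ b c ⊆ range g := hseg ▸ image_subset_range _ _
  rw [← Measure.restrict_restrict_of_subset hsub, ← hmap, hausdorffMeasure_real,
    hemb.setIntegral_map, hseg, preimage_image_eq _ hg.injective, integral_Icc_eq_integral_Ioc,
    ← intervalIntegral.integral_of_le hl0.le]
  simp_rw [← hgl]
  have := intervalIntegral.mul_integral_comp_mul_left (a := 0) (b := 1) (f := fun t => F (g t)) l
  rw [this]
  simp

variable {Ω : Set Plane} {𝒯 : Triangulation Ω}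

theorem cross_sq_add_inner_sq (u w : Plane) : cross u w ^ 2 + ⟪u, w⟫ ^ 2 = ‖u‖ ^ 2 * ‖w‖ ^ 2 := by
  simp only [cross, EuclideanSpace.norm_sq_eq, PiLp.inner_apply, Fin.sum_univ_two,
    Real.norm_eq_abs, sq_abs, RCLike.inner_apply, conj_trivial]
  ring

theorem edge_coe (T : 𝒯.Triangle) (a : T.vertices) :
    ((T.edge a).1 : Set Plane) = (T.1 : Set Plane) \ {a.1} := by
  classical
  simp [Triangulation.Triangle.edge]

/-- The normal is orthogonal to the edge. -/
theorem inner_sub_normal (T : 𝒯.Triangle) (a : T.vertices) {x y : Plane}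
    (hx : x ∈ (T.edge a).carrier) (hy : y ∈ (T.edge a).carrier) :
    ⟪x - y, T.normal a⟫ = 0 := by
  have hv : x - y ∈ vectorSpan ℝ ((T.edge a).1 : Set Plane) := by
    rw [← direction_affineSpan]
    exact AffineSubspace.vsub_mem_direction (convexHull_subset_affineSpan _ hx)
      (convexHull_subset_affineSpan _ hy)
  rw [Triangulation.Triangle.normal, real_inner_smul_right, Triangulation.Triangle.altitude,
    Submodule.inner_right_of_mem_orthogonal hv (Submodule.starProjection_apply_mem _ _), mul_zero]

theorem edge_nonempty (T : 𝒯.Triangle) (a : T.vertices) : (T.edge a).1.Nonempty :=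
  Finset.card_pos.1 (by rw [(T.edge a).2.2]; norm_num)

/-- On the edge opposite to `a`, the normal component of `x - a` is the altitude. -/
theorem inner_sub_vertex_normal (T : 𝒯.Triangle) (a : T.vertices) {x : Plane}
    (hx : x ∈ (T.edge a).carrier) : ⟪x - a.1, T.normal a⟫ = ‖T.altitude a‖ := by
  have hc : (T.edge a).1.centroid ℝ id ∈ (T.edge a).carrier :=
    Finset.centroid_mem_convexHull _ (edge_nonempty T a)
  have h1 := inner_sub_normal T a hx hc
  have h2 : ⟪(T.edge a).1.centroid ℝ id - a.1, T.altitude a⟫ = ‖T.altitude a‖ ^ 2 := by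
    set K := (vectorSpan ℝ ((T.edge a).1 : Set Plane))ᗮ with hK
    set w := (T.edge a).1.centroid ℝ id - a.1 with hw
    have : T.altitude a = K.starProjection w := rfl
    rw [this, ← real_inner_self_eq_norm_sq, ← sub_eq_zero, ← inner_sub_left]
    exact Submodule.starProjection_inner_eq_zero w _ (Submodule.starProjection_apply_mem _ _)
  have h3 : x - a.1 = (x - (T.edge a).1.centroid ℝ id) + ((T.edge a).1.centroid ℝ id - a.1) := by
    abel
  rw [h3, inner_add_left, h1, zero_add, Triangulation.Triangle.normal, real_inner_smul_right, h2]
  by_cases h0 : ‖T.altitude a‖ = 0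
  · simp [h0]
  · field_simp

theorem norm_altitude_mul (T : 𝒯.Triangle) (a : T.vertices) {b c : Plane}
    (h : ((T.edge a).1 : Set Plane) = {b, c}) :
    ‖T.altitude a‖ * ‖c - b‖ = |cross (b - a.1) (c - a.1)| := by
  have hb : b ∈ (T.edge a).carrier := subset_convexHull ℝ _ (by rw [h]; simp)
  have hc : c ∈ (T.edge a).carrier := subset_convexHull ℝ _ (by rw [h]; simp)
  set V := vectorSpan ℝ ((T.edge a).1 : Set Plane) with hV
  set g := (T.edge a).1.centroid ℝ id with hg
  have hgm : g ∈ (T.edge a).carrier := Finset.centroid_mem_convexHull _ (edge_nonempty T a)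
  have hgb : g - b ∈ V := by
    rw [hV, ← direction_affineSpan]
    exact AffineSubspace.vsub_mem_direction (convexHull_subset_affineSpan _ hgm)
      (convexHull_subset_affineSpan _ hb)
  have hcb : c - b ∈ V := by
    rw [hV, h]
    exact vsub_mem_vectorSpan ℝ (by simp) (by simp)
  have halt : T.altitude a = Vᗮ.starProjection (g - a.1) := rfl
  have hperp : ⟪T.altitude a, c - b⟫ = 0 := by
    rw [halt]
    exact Submodule.inner_left_of_mem_orthogonal hcb (Submodule.starProjection_apply_mem _ _)
  have hdiff : (b - a.1) - T.altitude a ∈ V := by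
    have h1 : (g - a.1) - T.altitude a ∈ Vᗮᗮ := by
      rw [halt]
      exact Submodule.sub_starProjection_mem_orthogonal _
    rw [Submodule.orthogonal_orthogonal] at h1
    have := V.sub_mem h1 hgb
    convert this using 1
    abel
  rw [hV, h, vectorSpan_pair] at hdiff
  obtain ⟨k, hk⟩ := Submodule.mem_span_singleton.1 hdiff
  have hcross : cross (b - a.1) (c - a.1) = cross (T.altitude a) (c - b) := by
    have hb' : b - a.1 = T.altitude a + k • (b - c) := by
      have : k • (b - c) = b - a.1 - T.altitude a := hk
      rw [this]; abel
    have hc' : c - a.1 = (b - a.1) + (c - b) := by abel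
    rw [hc', hb']
    simp only [cross, PiLp.add_apply, PiLp.smul_apply, PiLp.sub_apply, smul_eq_mul]
    ring
  have hsq := cross_sq_add_inner_sq (T.altitude a) (c - b)
  rw [hperp, ← mul_pow] at hsq
  rw [hcross, ← abs_of_nonneg (by positivity : 0 ≤ ‖T.altitude a‖ * ‖c - b‖)]
  exact ((sq_eq_sq_iff_abs_eq_abs _ _).1 (by linarith)).symm

/-! ### The weak gradient on a triangle, transported to the reference triangle -/

/-- The vertices of a triangle in the order given by a numbering. -/
def vert (T : 𝒯.Triangle) (e : Fin 3 ≃ T.vertices) (i : Fin 3) : Plane := (e i).1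

theorem range_vert (T : 𝒯.Triangle) (e : Fin 3 ≃ T.vertices) :
    range (vert T e) = (T.1 : Set Plane) := by
  ext x
  constructor
  · rintro ⟨i, rfl⟩; exact (e i).2
  · intro hx; exact ⟨e.symm ⟨x, hx⟩, by simp [vert]⟩

theorem carrier_eq_convexHull (T : 𝒯.Triangle) (e : Fin 3 ≃ T.vertices) :
    T.carrier = convexHull ℝ (range (vert T e)) := by
  rw [range_vert]; rfl

theorem carrier_eq_image (T : 𝒯.Triangle) (e : Fin 3 ≃ T.vertices) :
    T.carrier = refMap (vert T e) '' refTriangle := by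
  rw [carrier_eq_convexHull T e, image_refMap]

theorem volume_carrier_pos (T : 𝒯.Triangle) : 0 < volume T.carrier :=
  (isOpen_interior.measure_pos volume (interior_carrier_nonempty T)).trans_le
    (measure_mono interior_subset)

theorem jac_vert_ne_zero (T : 𝒯.Triangle) (e : Fin 3 ≃ T.vertices) : jac (vert T e) ≠ 0 := by
  intro h
  have := volume_carrier_pos T
  rw [carrier_eq_convexHull T e, volume_convexHull, h] at this
  simp at this

theorem volume_real_carrier (T : 𝒯.Triangle) (e : Fin 3 ≃ T.vertices) :
    volume.real T.carrier = |jac (vert T e)| / 2 := by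
  rw [carrier_eq_convexHull T e, Measure.real, volume_convexHull, ENNReal.toReal_mul,
    ENNReal.toReal_ofReal (abs_nonneg _), ← Measure.real, volume_real_refTriangle]
  ring

/-- The endpoints of the reference edges, as indices of vertices. -/
def refEnds : Fin 3 → Fin 3 × Fin 3 := ![(1, 2), (0, 2), (0, 1)]

theorem refMap_refEdge (a : Fin 3 → Plane) (i : Fin 3) (s : ℝ) :
    refMap a (refEdge i s) = a (refEnds i).1 + s • (a (refEnds i).2 - a (refEnds i).1) := by
  rw [refMap_apply]
  fin_cases i
  · simp only [refEdge, refEnds, Fin.zero_eta, Matrix.cons_val_zero, Matrix.cons_val_one]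
    module
  · simp [refEdge, refEnds]
  · simp [refEdge, refEnds]

theorem edge_vert (T : 𝒯.Triangle) (e : Fin 3 ≃ T.vertices) (i : Fin 3) :
    ((T.edge (e i)).1 : Set Plane) = {vert T e (refEnds i).1, vert T e (refEnds i).2} := by
  have hinj : Function.Injective (vert T e) := fun k l h => e.injective (Subtype.ext h)
  rw [edge_coe, ← range_vert T e]
  have : (e i).1 = vert T e i := rfl
  rw [this, ← image_univ, ← image_singleton, ← image_pair, ← image_sdiff hinj]
  congr 1
  ext k
  fin_cases i <;> fin_cases k <;> simp [refEnds]

theorem cross_refEnds (a : Fin 3 → Plane) (i : Fin 3) :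
    |cross (a (refEnds i).1 - a i) (a (refEnds i).2 - a i)| = |jac a| := by
  rw [jac]
  fin_cases i
  · rfl
  · rw [← abs_neg]
    congr 1
    simp [refEnds, cross]
    ring
  · congr 1
    simp [refEnds, cross]
    ring

/-- The flux of a radial field through the edge opposite to its centre. -/
theorem integral_edge_radial (T : 𝒯.Triangle) (e : Fin 3 ≃ T.vertices) (i : Fin 3) (p : Poly)
    (f : Plane → ℝ) :
    ∫ x in (T.edge (e i)).carrier, f x * ⟪(radial (vert T e i) p).at x, T.normal (e i)⟫
      ∂(Measure.hausdorffMeasure 1) =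
    |jac (vert T e)| * ∫ s in (0 : ℝ)..1, f (refMap (vert T e) (refEdge i s)) *
      (pullback (vert T e) p).at (refEdge i s) := by
  have hE := edge_vert T e i
  have hc : (T.edge (e i)).carrier =
      segment ℝ (vert T e (refEnds i).1) (vert T e (refEnds i).2) := by
    rw [Triangulation.Edge.carrier, hE, convexHull_pair]
  have hne : vert T e (refEnds i).1 ≠ vert T e (refEnds i).2 := fun h => by
    have : (refEnds i).1 = (refEnds i).2 := e.injective (Subtype.ext h)
    fin_cases i <;> simp [refEnds] at this
  have hm : MeasurableSet (T.edge (e i)).carrier :=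
    ((T.edge (e i)).1.finite_toSet.isCompact_convexHull (𝕜 := ℝ)).measurableSet
  rw [setIntegral_congr_fun (g := fun x => ‖T.altitude (e i)‖ * (f x * p.at x)) hm fun x hx => by
    have := inner_sub_vertex_normal T (e i) hx
    simp only [radial_at, real_inner_smul_left]
    change _ * (_ * ⟪x - (e i).1, _⟫) = _
    rw [this]; ring, integral_const_mul, hc, integral_segment hne, ← mul_assoc,
    norm_altitude_mul T (e i) hE]
  change |cross (_ - vert T e i) (_ - vert T e i)| * _ = _
  rw [cross_refEnds]
  simp_rw [pullback_at, refMap_refEdge]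

/-- A radial field centred at a vertex has no flux through the edges that contain this vertex. -/
theorem integral_edge_radial_eq_zero (T : 𝒯.Triangle) (e : Fin 3 ≃ T.vertices) {i k : Fin 3}
    (hik : k ≠ i) (p : Poly) (f : Plane → ℝ) :
    ∫ x in (T.edge (e k)).carrier, f x * ⟪(radial (vert T e i) p).at x, T.normal (e k)⟫
      ∂(Measure.hausdorffMeasure 1) = 0 := by
  have hm : MeasurableSet (T.edge (e k)).carrier :=
    ((T.edge (e k)).1.finite_toSet.isCompact_convexHull (𝕜 := ℝ)).measurableSet
  have hv : vert T e i ∈ (T.edge (e k)).carrier := by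
    refine subset_convexHull ℝ _ ?_
    rw [edge_coe]
    exact ⟨(e i).2, fun h => hik (e.injective (Subtype.ext h)).symm⟩
  rw [setIntegral_congr_fun (g := fun _ => (0 : ℝ)) hm fun x hx => by
    simp [radial_at, real_inner_smul_left, inner_sub_normal T (e k) hx hv]]
  simp

/-- The equation of the discrete weak gradient, for radial test fields, in terms of the moments on
the reference triangle. -/
theorem integral_weakGradient_radial {j l k : ℕ} (v : Sh 𝒯 j l) (T : 𝒯.Triangle)
    (e : Fin 3 ≃ T.vertices) {f : Poly} {b : Fin 3 → Poly}
    (hf : ∀ x ∈ T.carrier, v.v0 T x = f.at x)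
    (hb : ∀ i, ∀ x ∈ (T.edge (e i)).carrier, v.vb (T.edge (e i)) x = (b i).at x)
    (i : Fin 3) {p : Poly} (hp : p.totalDegree ≤ k) :
    ∫ x in T.carrier, ⟪(v.weakGradient k T).1.at x, (radial (vert T e i) p).at x⟫ =
      |jac (vert T e)| * refMoment i (pullback (vert T e) p) (pullback (vert T e) f)
        (pullback (vert T e) (b i)) := by
  have h := v.weakGradient_spec k T ⟨radial (vert T e i) p, radial_mem_RT _ hp⟩
  rw [h, ← e.sum_comp, Finset.sum_eq_single i
    (fun k _ hk => integral_edge_radial_eq_zero T e hk p _) (by simp), integral_edge_radial,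
    setIntegral_congr_fun (isCompact_carrier T).measurableSet
      (g := fun x => f.at x * (radial (vert T e i) p).div.at x) (fun x hx => by simp [hf x hx]),
    carrier_eq_convexHull T e, integral_convexHull (jac_vert_ne_zero T e), refMoment]
  have h1 : ∀ s ∈ uIcc (0 : ℝ) 1, v.vb (T.edge (e i)) (refMap (vert T e) (refEdge i s)) *
      (pullback (vert T e) p).at (refEdge i s) =
      (pullback (vert T e) (b i)).at (refEdge i s) * (pullback (vert T e) p).at (refEdge i s) := by
    intro s hs
    rw [uIcc_of_le zero_le_one] at hs
    rw [pullback_at _ (b i), hb]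
    rw [Triangulation.Edge.carrier, edge_vert, convexHull_pair, segment_eq_image']
    exact ⟨s, hs, (refMap_refEdge _ _ _).symm⟩
  rw [intervalIntegral.integral_congr h1]
  simp_rw [pullback_radial_div, pullback_at _ f]
  ring

/-! ### Local stability -/

theorem sq_integral_le {s : Set Plane} (hs : IsCompact s) {g : Plane → ℝ} (hg : Continuous g) :
    (∫ x in s, g x) ^ 2 ≤ volume.real s * ∫ x in s, g x ^ 2 := by
  have hi : ∀ {f : Plane → ℝ}, Continuous f → IntegrableOn f s := fun hf =>
    hf.continuousOn.integrableOn_compact hs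
  -- The integral of `(V g - ∫ g)²` is nonnegative, where `V` is the volume of `s`.
  have key : 0 ≤ ∫ x in s, (volume.real s * g x - ∫ y in s, g y) ^ 2 :=
    integral_nonneg fun _ => sq_nonneg _
  set I := ∫ y in s, g y with hI
  set V := volume.real s with hV
  have hexp : ∀ x, (V * g x - I) ^ 2 = V ^ 2 * g x ^ 2 - (2 * V * I) * g x + I ^ 2 := fun x => by
    ring
  simp_rw [hexp] at key
  have i1 : IntegrableOn (fun x => V ^ 2 * g x ^ 2) s := hi (by fun_prop)
  have i2 : IntegrableOn (fun x => 2 * V * I * g x) s := hi (by fun_prop)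
  have i4 : IntegrableOn (fun x => V ^ 2 * g x ^ 2 - 2 * V * I * g x) s := i1.sub i2
  have i3 : IntegrableOn (fun _ => I ^ 2) s := hi continuous_const
  rw [integral_add i4 i3, integral_sub i1 i2, integral_const_mul, integral_const_mul,
    setIntegral_const, ← hI, ← hV, smul_eq_mul] at key
  rcases (measureReal_nonneg : 0 ≤ volume.real s).eq_or_lt with h0 | h0
  · have : volume s = 0 := by
      rw [eq_comm, measureReal_eq_zero_iff hs.measure_lt_top.ne] at h0
      exact h0
    have hz : I = 0 := by rw [hI, Measure.restrict_eq_zero.2 this]; simp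
    rw [hz, hV, ← h0]; simp
  · rw [← hV] at h0
    have : 0 ≤ V * (V * (∫ x in s, g x ^ 2) - I ^ 2) := by nlinarith
    linarith [nonneg_of_mul_nonneg_right this h0]

/-- The discrete weak gradient on a shape regular triangle controls, in the maximum norm, the
oscillation of the interior part and its distance to the boundary part. -/
theorem exists_local_stability (j : ℕ) {κ : ℝ} (hκ : 0 < κ) :
    ∃ C : ℝ, 0 < C ∧ ∀ {Ω : Set Plane} {𝒯 : Triangulation Ω} (v : Sh 𝒯 j j) (T : 𝒯.Triangle)
      (h : ℝ) (z : Plane), 0 < h → Metric.diam T.carrier ≤ h →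
      Metric.closedBall z (κ * h) ⊆ T.carrier →
      (∀ x ∈ T.carrier, ∀ y ∈ T.carrier, |v.v0 T x - v.v0 T y| ≤
        C * √(∫ x in T.carrier, ‖(v.weakGradient j T).1.at x‖ ^ 2)) ∧
      ∀ a, ∀ x ∈ (T.edge a).carrier, |v.vb (T.edge a) x - v.v0 T x| ≤
        C * √(∫ x in T.carrier, ‖(v.weakGradient j T).1.at x‖ ^ 2) := by
  obtain ⟨C, hC, hstab⟩ := exists_refMoment_stability j
  refine ⟨C / κ, by positivity, fun v T h z hh hdiam hball => ?_⟩
  let e : Fin 3 ≃ T.vertices := (Finset.equivFinOfCardEq T.2.2).symm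
  obtain ⟨f, hfdeg, hf⟩ := v.v0_poly T
  choose b hbdeg hb using fun i => v.vb_poly (T.edge (e i))
  set G := (v.weakGradient j T).1 with hG
  set N := √(∫ x in T.carrier, ‖G.at x‖ ^ 2) with hN
  set a := vert T e with ha
  have hJ0 := jac_vert_ne_zero T e
  rw [← ha] at hJ0
  have hJ : 2 * (κ * h) ^ 2 ≤ |jac a| := by
    have h1 : volume.real (Metric.closedBall z (κ * h)) ≤ volume.real T.carrier :=
      measureReal_mono hball (isCompact_carrier T).measure_lt_top.ne
    rw [volume_real_carrier T e, Measure.real, EuclideanSpace.volume_closedBall_fin_two,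
      ← ENNReal.ofReal_pow (by positivity), ENNReal.toReal_mul,
      ENNReal.toReal_ofReal (by positivity)] at h1
    rw [ENNReal.toReal_ofReal Real.pi_nonneg] at h1
    nlinarith [Real.pi_gt_three, sq_nonneg (κ * h)]
  have hNsq : N ^ 2 = ∫ x in T.carrier, ‖G.at x‖ ^ 2 :=
    Real.sq_sqrt (integral_nonneg fun _ => sq_nonneg _)
  have hmom : ∀ i, ∀ p : Poly, p.totalDegree ≤ j → (∀ x ∈ refTriangle, |p.at x| ≤ 1) →
      |refMoment i p (pullback a f) (pullback a (b i))| ≤ N / κ := by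
    intro i p hp hp1
    obtain ⟨q, hq, hqp⟩ := exists_pullback_eq hJ0 p
    have hid := integral_weakGradient_radial v T e hf hb i (hq.trans hp)
    rw [← ha, hqp, ← hG] at hid
    have hq1 : ∀ x ∈ T.carrier, ‖(radial (a i) q).at x‖ ≤ h := by
      intro x hx
      have hxa : ‖x - a i‖ ≤ h := by
        rw [← dist_eq_norm]
        exact (Metric.dist_le_diam_of_mem (isCompact_carrier T).isBounded hx
          (subset_convexHull ℝ _ (e i).2)).trans hdiam
      rw [carrier_eq_image T e] at hx
      obtain ⟨y, hy, rfl⟩ := hx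
      have := hp1 y hy
      rw [← hqp, pullback_at] at this
      rw [radial_at, norm_smul, Real.norm_eq_abs]
      calc _ ≤ 1 * h := mul_le_mul this hxa (norm_nonneg _) zero_le_one
        _ = h := one_mul h
    have hcG : Continuous fun x => ‖G.at x‖ := (continuous_field_at G).norm
    have hle : |∫ x in T.carrier, ⟪G.at x, (radial (a i) q).at x⟫| ≤
        h * ∫ x in T.carrier, ‖G.at x‖ := by
      rw [← integral_const_mul]
      refine (abs_integral_le_integral_abs).trans (setIntegral_mono_on ?_ ?_
        (isCompact_carrier T).measurableSet fun x hx => ?_)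
      · exact ((continuous_field_at G).inner
          (continuous_field_at _)).abs.continuousOn.integrableOn_compact (isCompact_carrier T)
      · exact (hcG.const_mul h).continuousOn.integrableOn_compact (isCompact_carrier T)
      · rw [mul_comm]
        exact (abs_real_inner_le_norm _ _).trans
          (mul_le_mul_of_nonneg_left (hq1 x hx) (norm_nonneg _))
    have hcs := sq_integral_le (isCompact_carrier T) hcG
    rw [← hNsq, volume_real_carrier T e, ← ha] at hcs
    rw [hid, abs_mul, abs_abs] at hle
    set m := |refMoment i p (pullback a f) (pullback a (b i))| with hm
    have hJpos : 0 < |jac a| := abs_pos.2 hJ0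
    have h1 : (|jac a| * m) ^ 2 ≤ h ^ 2 * (|jac a| / 2 * N ^ 2) :=
      (pow_le_pow_left₀ (by positivity) hle 2).trans (by
        rw [mul_pow]; exact mul_le_mul_of_nonneg_left hcs (sq_nonneg _))
    have h2 : |jac a| * m ^ 2 ≤ h ^ 2 * N ^ 2 / 2 := by
      have : |jac a| * (|jac a| * m ^ 2) ≤ |jac a| * (h ^ 2 * N ^ 2 / 2) := by nlinarith
      exact le_of_mul_le_mul_left this hJpos
    have h3 : 2 * (κ * h) ^ 2 * m ^ 2 ≤ h ^ 2 * N ^ 2 / 2 :=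
      (mul_le_mul_of_nonneg_right hJ (sq_nonneg m)).trans h2
    have h4 : κ ^ 2 * m ^ 2 ≤ N ^ 2 := by
      have : h ^ 2 * (κ ^ 2 * m ^ 2) ≤ h ^ 2 * N ^ 2 := by nlinarith [sq_nonneg (h * N)]
      exact le_of_mul_le_mul_left this (by positivity)
    rw [le_div_iff₀ hκ]
    refine abs_le_of_sq_le_sq' ?_ (Real.sqrt_nonneg _) |>.2
    linarith [mul_pow m κ 2]
  obtain ⟨h1, h2⟩ := hstab (pullback a f) (fun i => pullback a (b i)) (N / κ)
    ((totalDegree_pullback_le _ _).trans hfdeg)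
    (fun i => (totalDegree_pullback_le _ _).trans (hbdeg i)) hmom
  have hCN : C * (N / κ) = C / κ * N := by ring
  rw [hCN] at h1 h2
  constructor
  · intro x hx y hy
    rw [hf x hx, hf y hy]
    rw [carrier_eq_image T e] at hx hy
    obtain ⟨x', hx', rfl⟩ := hx
    obtain ⟨y', hy', rfl⟩ := hy
    rw [← ha, ← pullback_at, ← pullback_at]
    exact h1 x' hx' y' hy'
  · intro w x hx
    obtain ⟨i, rfl⟩ := e.surjective w
    have hxT : x ∈ T.carrier :=
      convexHull_mono (by rw [edge_coe]; exact sdiff_subset) hx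
    rw [hb i x hx, hf x hxT]
    rw [Triangulation.Edge.carrier, edge_vert, convexHull_pair, segment_eq_image'] at hx
    obtain ⟨s, hs, rfl⟩ := hx
    have := h2 i s hs
    rw [pullback_at, pullback_at, refMap_refEdge] at this
    exact this

/-! ### Neighbours across an edge -/

/-- The barycentric coordinates of a triangle. -/
def bary (T : 𝒯.Triangle) : AffineBasis T.vertices ℝ Plane where
  toFun := fun a => a.1
  ind' := 𝒯.complex.indep T.2.1
  tot' := by
    have h := 𝒯.complex.indep T.2.1
    exact (h.affineSpan_eq_top_iff_card_eq_finrank_add_one).2 (by simp [T.2.2])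

theorem range_bary (T : 𝒯.Triangle) : range (bary T) = (T.1 : Set Plane) :=
  Subtype.range_coe

theorem mem_carrier_iff (T : 𝒯.Triangle) {x : Plane} :
    x ∈ T.carrier ↔ ∀ a, 0 ≤ (bary T).coord a x := by
  rw [Triangulation.Triangle.carrier, ← range_bary, AffineBasis.convexHull_eq_nonneg_coord]
  rfl

theorem mem_interior_carrier (T : 𝒯.Triangle) {x : Plane} (h : ∀ a, 0 < (bary T).coord a x) :
    x ∈ interior T.carrier := by
  rw [Triangulation.Triangle.carrier, ← range_bary, AffineBasis.interior_convexHull]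
  exact h

theorem coord_eq_zero_of_mem_convexHull (T : 𝒯.Triangle) {s : Set Plane} (hs : s ⊆ T.1)
    {a : T.vertices} (ha : a.1 ∉ s) {x : Plane} (hx : x ∈ convexHull ℝ s) :
    (bary T).coord a x = 0 := by
  classical
  have hc : Convex ℝ {y : Plane | (bary T).coord a y = 0} :=
    (convex_singleton (0 : ℝ)).affine_preimage ((bary T).coord a)
  refine convexHull_min (fun y hy => ?_) hc hx
  have h := (bary T).coord_apply a ⟨y, hs hy⟩
  have hne : a ≠ ⟨y, hs hy⟩ := fun h => ha (by rw [h]; exact hy)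
  rw [if_neg hne] at h
  exact h

theorem mem_convexHull_of_coord_eq_zero (T : 𝒯.Triangle) {s : Set Plane}
    {x : Plane} (hx : x ∈ T.carrier) (h : ∀ a : T.vertices, a.1 ∉ s → (bary T).coord a x = 0) :
    x ∈ convexHull ℝ s := by
  classical
  have h1 := (bary T).linear_combination_coord_eq_self x
  have h2 := (bary T).sum_coord_apply_eq_one x
  rw [← Finset.sum_filter_of_ne (p := fun a : T.vertices => a.1 ∈ s)
    (fun a _ ha => by by_contra hs; exact ha (by rw [h a hs, zero_smul]))] at h1
  rw [← Finset.sum_filter_of_ne (p := fun a : T.vertices => a.1 ∈ s)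
    (fun a _ ha => by by_contra hs; exact ha (h a hs))] at h2
  rw [← h1]
  exact (convex_convexHull ℝ s).sum_mem (fun a _ => (mem_carrier_iff T).1 hx a) h2
    (fun a ha => subset_convexHull _ _ (Finset.mem_filter.1 ha).2)

theorem mem_edge_iff (T : 𝒯.Triangle) (a : T.vertices) {x : Plane} :
    x ∈ (T.edge a).carrier ↔ x ∈ T.carrier ∧ (bary T).coord a x = 0 := by
  rw [Triangulation.Edge.carrier, edge_coe]
  constructor
  · intro hx
    exact ⟨convexHull_mono sdiff_subset hx,
      coord_eq_zero_of_mem_convexHull T sdiff_subset (by simp) hx⟩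
  · rintro ⟨hx, h0⟩
    refine mem_convexHull_of_coord_eq_zero T hx fun b hb => ?_
    have : b = a := by
      by_contra hne
      exact hb ⟨b.2, fun h => hne (Subtype.ext h)⟩
    rwa [this]

/-- A point of an edge that is not a vertex lies in the relative interior of the edge. -/
theorem coord_pos_of_mem_edge (T : 𝒯.Triangle) {a b : T.vertices} (hab : b ≠ a) {x : Plane}
    (hx : x ∈ (T.edge a).carrier) (hv : x ∉ T.1) : 0 < (bary T).coord b x := by
  classical
  obtain ⟨hxT, ha⟩ := (mem_edge_iff T a).1 hx
  refine lt_of_le_of_ne ((mem_carrier_iff T).1 hxT b) fun h0 => hv ?_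
  have hcard : ((T.1.erase a.1).erase b.1).card = 1 := by
    rw [Finset.card_erase_of_mem (Finset.mem_erase.2 ⟨fun h => hab (Subtype.ext h), b.2⟩),
      Finset.card_erase_of_mem a.2, T.2.2]
  obtain ⟨c, hc⟩ := Finset.card_eq_one.1 hcard
  have hm : x ∈ convexHull ℝ (((T.1.erase a.1).erase b.1 : Finset Plane) : Set Plane) := by
    refine mem_convexHull_of_coord_eq_zero T hxT fun d hd => ?_
    by_cases hda : d = a
    · rw [hda, ha]
    by_cases hdb : d = b
    · rw [hdb, ← h0]
    · exact absurd (by simp [hda, hdb]) hd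
  rw [hc, Finset.coe_singleton, convexHull_singleton] at hm
  have hcm : c ∈ (T.1.erase a.1).erase b.1 := by rw [hc]; simp
  rw [mem_singleton_iff.1 hm]
  exact Finset.mem_of_mem_erase (Finset.mem_of_mem_erase hcm)

theorem carrier_subset_closure (T : 𝒯.Triangle) : T.carrier ⊆ closure Ω := by
  rw [← 𝒯.space_eq]
  exact 𝒯.complex.convexHull_subset_space T.2.1

theorem exists_triangle_mem {x : Plane} (hx : x ∈ closure Ω) : ∃ T : 𝒯.Triangle, x ∈ T.carrier := by
  rw [← 𝒯.space_eq] at hx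
  obtain ⟨s, hs, hxs⟩ := Geometry.SimplicialComplex.mem_space_iff.1 hx
  obtain ⟨t, ht, hst, hc⟩ := 𝒯.pure s hs
  exact ⟨⟨t, ht, hc⟩, convexHull_mono (Finset.coe_subset.2 hst) hxs⟩

/-- A triangle that meets the relative interior of an edge has it as an edge. -/
theorem exists_edge_eq (T T' : 𝒯.Triangle) {a : T.vertices} {x : Plane}
    (hx : x ∈ T.carrier) (hx' : x ∈ T'.carrier) (hpos : ∀ b, b ≠ a → 0 < (bary T).coord b x) :
    ∃ a' : T'.vertices, T'.edge a' = T.edge a := by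
  classical
  have hm : x ∈ convexHull ℝ ((T.1 : Set Plane) ∩ T'.1) := by
    rw [← 𝒯.complex.convexHull_inter_convexHull T.2.1 T'.2.1]
    exact ⟨hx, hx'⟩
  have hsub : T.1.erase a.1 ⊆ T'.1 := by
    intro b hb
    obtain ⟨hba, hbT⟩ := Finset.mem_erase.1 hb
    by_contra hbT'
    have h0 := coord_eq_zero_of_mem_convexHull T (a := ⟨b, hbT⟩) inter_subset_left
      (fun h => hbT' h.2) hm
    exact (hpos ⟨b, hbT⟩ fun h => hba (congrArg Subtype.val h)).ne' h0
  have hcard : (T'.1 \ T.1.erase a.1).card = 1 := by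
    rw [Finset.card_sdiff_of_subset hsub, Finset.card_erase_of_mem a.2, T.2.2, T'.2.2]
  obtain ⟨c, hc⟩ := Finset.card_eq_one.1 hcard
  have hcm : c ∈ T'.1 \ T.1.erase a.1 := by rw [hc]; simp
  refine ⟨⟨c, (Finset.mem_sdiff.1 hcm).1⟩, Subtype.ext (Finset.coe_injective ?_)⟩
  rw [edge_coe]
  change (T'.1 : Set Plane) \ {c} = _
  rw [← Finset.coe_singleton, ← hc, Finset.coe_sdiff, sdiff_sdiff_cancel_left
    (Finset.coe_subset.2 hsub), edge_coe, Finset.coe_erase]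

/-- The horizontal unit vector. -/
def horizontal : Plane := EuclideanSpace.single 0 1

theorem horizontal_fst : horizontal 0 = 1 := by simp [horizontal]

theorem horizontal_snd : horizontal 1 = 0 := by simp [horizontal]

theorem coord_add_smul (T : 𝒯.Triangle) (a : T.vertices) (x v : Plane) (t : ℝ) :
    (bary T).coord a (x + t • v) = (bary T).coord a x + t * ((bary T).coord a).linear v := by
  have h := ((bary T).coord a).map_vadd x (t • v)
  rw [vadd_eq_add, vadd_eq_add, map_smul, smul_eq_mul] at h
  rw [add_comm x, h, add_comm]

/-- To the left of a point on an edge that does not lie on the boundary of the domain, there is a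
triangle with the same edge. -/
theorem exists_left_neighbour (hΩ : IsOpen Ω) (T : 𝒯.Triangle) (a : T.vertices) {z : Plane}
    (hz : z ∈ (T.edge a).carrier) (hgen : ∀ T : 𝒯.Triangle, z ∉ T.1)
    (hfr : ¬ (T.edge a).carrier ⊆ frontier Ω) :
    ∃ (T' : 𝒯.Triangle) (a' : T'.vertices), T'.edge a' = T.edge a ∧
      ∃ δ : ℝ, 0 < δ ∧ z + (-δ) • horizontal ∈ T'.carrier := by
  obtain ⟨hzT, hza⟩ := (mem_edge_iff T a).1 hz
  have hzpos : ∀ b, b ≠ a → 0 < (bary T).coord b z := fun b hb =>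
    coord_pos_of_mem_edge T hb hz (hgen T)
  obtain ⟨w, hwe, hwfr⟩ := not_subset.1 hfr
  obtain ⟨hwT, hwa⟩ := (mem_edge_iff T a).1 hwe
  have hwΩ : w ∈ Ω := by
    by_contra h
    exact hwfr (hΩ.frontier_eq ▸ ⟨carrier_subset_closure T hwT, h⟩)
  -- Move `w` towards `z`, into the relative interior of the edge, without leaving `Ω`.
  obtain ⟨z₀, hz₀Ω, hz₀T, hz₀a, hz₀pos⟩ : ∃ z₀ ∈ Ω, z₀ ∈ T.carrier ∧ (bary T).coord a z₀ = 0 ∧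
      ∀ b, b ≠ a → 0 < (bary T).coord b z₀ := by
    have hc : Filter.Tendsto (fun t : ℝ => w + t • (z - w)) (nhdsWithin 0 (Ioi 0)) (nhds w) := by
      have : Continuous fun t : ℝ => w + t • (z - w) := by fun_prop
      simpa using (this.tendsto 0).mono_left nhdsWithin_le_nhds
    have hev := (hc.eventually (hΩ.mem_nhds hwΩ)).and (Ioo_mem_nhdsGT (zero_lt_one (α := ℝ)))
    obtain ⟨t, htΩ, ht0, ht1⟩ := hev.exists
    have hcoord : ∀ b, (bary T).coord b (w + t • (z - w)) =
        (1 - t) * (bary T).coord b w + t * (bary T).coord b z := by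
      intro b
      have h1 := coord_add_smul T b w (z - w) 1
      rw [one_smul, add_sub_cancel, one_mul] at h1
      rw [coord_add_smul, h1]
      ring
    have h1t : 0 ≤ 1 - t := by linarith
    refine ⟨_, htΩ, (mem_carrier_iff T).2 fun b => ?_, ?_, fun b hb => ?_⟩
    · rw [hcoord]
      have h1 := (mem_carrier_iff T).1 hwT b
      have h2 := (mem_carrier_iff T).1 hzT b
      positivity
    · rw [hcoord, hwa, hza]; ring
    · rw [hcoord]
      have h1 := (mem_carrier_iff T).1 hwT b
      have h2 := hzpos b hb
      positivity
  -- Near `z₀` only triangles containing `z₀` occur, and these have the given edge.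
  obtain ⟨T', hz₀T', s, hs, hsT'⟩ : ∃ T' : 𝒯.Triangle, z₀ ∈ T'.carrier ∧
      ∃ s : ℝ, 0 < s ∧ z₀ + (-s) • horizontal ∈ T'.carrier := by
    let F : Set Plane := ⋃ T' ∈ {T' : 𝒯.Triangle | z₀ ∉ T'.carrier}, T'.carrier
    have hF : IsClosed F := (Set.toFinite _).isClosed_biUnion fun T' _ =>
      (isCompact_carrier T').isClosed
    have hzF : z₀ ∉ F := by simp [F]
    have hc : Filter.Tendsto (fun s : ℝ => z₀ + (-s) • horizontal) (nhdsWithin 0 (Ioi 0))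
        (nhds z₀) := by
      have : Continuous fun s : ℝ => z₀ + (-s) • horizontal := by fun_prop
      simpa using (this.tendsto 0).mono_left nhdsWithin_le_nhds
    have hev := ((hc.eventually (hΩ.mem_nhds hz₀Ω)).and
      (hc.eventually (hF.isOpen_compl.mem_nhds hzF))).and self_mem_nhdsWithin
    obtain ⟨s, ⟨hsΩ, hsF⟩, hs⟩ := hev.exists
    obtain ⟨T', hT'⟩ := exists_triangle_mem (𝒯 := 𝒯) (subset_closure hsΩ)
    refine ⟨T', ?_, s, hs, hT'⟩
    by_contra hcon
    exact hsF (mem_biUnion (x := T') hcon hT')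
  obtain ⟨a', ha'⟩ := exists_edge_eq T T' (a := a) hz₀T hz₀T' hz₀pos
  refine ⟨T', a', ha', ?_⟩
  have hze' : z ∈ (T'.edge a').carrier := ha' ▸ hz
  have hz₀e' : z₀ ∈ (T'.edge a').carrier := ha' ▸ (mem_edge_iff T a).2 ⟨hz₀T, hz₀a⟩
  have hza' := ((mem_edge_iff T' a').1 hze').2
  have hz₀a' := ((mem_edge_iff T' a').1 hz₀e').2
  have hslope : ((bary T').coord a').linear horizontal ≤ 0 := by
    have h := (mem_carrier_iff T').1 hsT' a'
    rw [coord_add_smul, hz₀a', zero_add] at h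
    by_contra hpos
    nlinarith [not_le.1 hpos]
  have hev : ∀ᶠ δ in nhdsWithin (0 : ℝ) (Ioi 0), ∀ b, b ≠ a' →
      0 < (bary T').coord b (z + (-δ) • horizontal) := by
    refine Filter.eventually_all.2 fun b => ?_
    by_cases hb : b = a'
    · exact Filter.Eventually.of_forall fun _ h => absurd hb h
    have hpos := coord_pos_of_mem_edge T' hb hze' (hgen T')
    have hc : Continuous fun δ : ℝ => (bary T').coord b (z + (-δ) • horizontal) :=
      (continuous_barycentric_coord (bary T') b).comp (by fun_prop)
    have ht : Filter.Tendsto (fun δ : ℝ => (bary T').coord b (z + (-δ) • horizontal))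
        (nhdsWithin 0 (Ioi 0)) (nhds ((bary T').coord b z)) := by
      simpa using (hc.tendsto 0).mono_left nhdsWithin_le_nhds
    filter_upwards [ht.eventually (lt_mem_nhds hpos)] with δ hδ _ using hδ
  obtain ⟨δ, hδ, hδ0⟩ := (hev.and self_mem_nhdsWithin).exists
  refine ⟨δ, hδ0, (mem_carrier_iff T').2 fun b => ?_⟩
  by_cases hb : b = a'
  · rw [hb, coord_add_smul, hza', zero_add]
    have : (0 : ℝ) < δ := hδ0
    nlinarith
  · exact (hδ b hb).le

/-! ### Summation along horizontal lines -/

/-- The triangles that meet the horizontal line at height `y`. -/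
def crossing (𝒯 : Triangulation Ω) (y : ℝ) : Set 𝒯.Triangle :=
  {T | ∃ x ∈ T.carrier, x 1 = y}

theorem exists_leftmost (T : 𝒯.Triangle) {y : ℝ} (hT : T ∈ crossing 𝒯 y) :
    ∃ z ∈ T.carrier, z 1 = y ∧ ∀ w ∈ T.carrier, w 1 = y → z 0 ≤ w 0 := by
  have hc : IsCompact (T.carrier ∩ {x : Plane | x 1 = y}) :=
    (isCompact_carrier T).inter_right (isClosed_eq (by fun_prop) continuous_const)
  obtain ⟨x, hx, hxy⟩ := hT
  obtain ⟨z, ⟨hz, hzy⟩, hmin⟩ := hc.exists_isMinOn ⟨x, hx, hxy⟩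
    (f := fun w : Plane => w 0) (by fun_prop)
  exact ⟨z, hz, hzy, fun w hw hwy => hmin ⟨hw, hwy⟩⟩

/-- A leftmost point of a triangle on a horizontal line lies on an edge. -/
theorem exists_mem_edge_of_leftmost (T : 𝒯.Triangle) {z : Plane} (hz : z ∈ T.carrier)
    (hmin : ∀ w ∈ T.carrier, w 1 = z 1 → z 0 ≤ w 0) :
    ∃ a, z ∈ (T.edge a).carrier := by
  by_contra! hno
  have hpos : ∀ a, 0 < (bary T).coord a z := fun a =>
    lt_of_le_of_ne ((mem_carrier_iff T).1 hz a) fun h0 => hno a ((mem_edge_iff T a).2 ⟨hz, h0.symm⟩)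
  have hint := mem_interior_carrier T hpos
  have hc : Filter.Tendsto (fun s : ℝ => z + (-s) • horizontal) (nhdsWithin 0 (Ioi 0))
      (nhds z) := by
    have : Continuous fun s : ℝ => z + (-s) • horizontal := by fun_prop
    simpa using (this.tendsto 0).mono_left nhdsWithin_le_nhds
  obtain ⟨s, hs, hs0⟩ := ((hc.eventually (mem_interior_iff_mem_nhds.1 hint)).and
    self_mem_nhdsWithin).exists
  have := hmin _ hs (by simp [horizontal_snd])
  simp only [PiLp.add_apply, PiLp.smul_apply, horizontal_fst, smul_eq_mul] at this
  have h0 : (0 : ℝ) < s := hs0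
  linarith

open Classical in
/-- Along a horizontal line that avoids all vertices, the interior part is bounded by the sum of
its oscillations over the triangles and of the jumps between interior and boundary part: go left
from triangle to triangle until the boundary of the domain is reached. -/
theorem abs_v0_le_sum_crossing (hΩ : IsOpen Ω) {j l : ℕ} {v : Sh 𝒯 j l} (hv : v ∈ Sh0 𝒯 j l)
    {K : 𝒯.Triangle → ℝ} (hK : ∀ T, 0 ≤ K T)
    (hosc : ∀ T, ∀ x ∈ T.carrier, ∀ y ∈ T.carrier, |v.v0 T x - v.v0 T y| ≤ K T)
    (hjump : ∀ T : 𝒯.Triangle, ∀ a, ∀ x ∈ (T.edge a).carrier,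
      |v.vb (T.edge a) x - v.v0 T x| ≤ K T)
    {y : ℝ} (hy : ∀ T : 𝒯.Triangle, ∀ x ∈ T.1, x 1 ≠ y) (T : 𝒯.Triangle) {x : Plane}
    (hx : x ∈ T.carrier) (hxy : x 1 = y) :
    |v.v0 T x| ≤ 3 * ∑ T' : 𝒯.Triangle, if T' ∈ crossing 𝒯 y then K T' else 0 := by
  choose! z hz hzy hmin using fun (T : 𝒯.Triangle) (hT : T ∈ crossing 𝒯 y) => exists_leftmost T hT
  let L : 𝒯.Triangle → Finset 𝒯.Triangle := fun T =>
    Finset.univ.filter fun T' => T' ∈ crossing 𝒯 y ∧ z T' 0 < z T 0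
  have key : ∀ (n : ℕ) (T : 𝒯.Triangle), (L T).card = n → ∀ x ∈ T.carrier, x 1 = y →
      |v.v0 T x| ≤ 2 * K T + 3 * ∑ T' ∈ L T, K T' := by
    intro n
    induction n using Nat.strong_induction_on with
    | _ n ih =>
      intro T hn x hx hxy
      have hT : T ∈ crossing 𝒯 y := ⟨x, hx, hxy⟩
      have hsum : ∀ s : Finset 𝒯.Triangle, 0 ≤ ∑ T' ∈ s, K T' := fun s =>
        Finset.sum_nonneg fun _ _ => hK _
      obtain ⟨a, ha⟩ := exists_mem_edge_of_leftmost T (hz T hT)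
        (fun w hw hwy => hmin T hT w hw (hwy.trans (hzy T hT)))
      have h1 := hosc T x hx _ (hz T hT)
      have h2 := hjump T a _ ha
      have h3 : |v.v0 T x| ≤ 2 * K T + |v.vb (T.edge a) (z T)| := by
        rw [abs_le] at h1 h2 ⊢
        constructor <;>
          linarith [neg_abs_le (v.vb (T.edge a) (z T)), le_abs_self (v.vb (T.edge a) (z T))]
      by_cases hfr : (T.edge a).carrier ⊆ frontier Ω
      · rw [hv _ hfr _ ha, abs_zero] at h3
        linarith [hsum (L T)]
      obtain ⟨T', a', hedge, δ, hδ, hmem⟩ := exists_left_neighbour hΩ T a ha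
        (fun T' h => hy T' _ h (hzy T hT)) hfr
      have hzT' : z T ∈ (T'.edge a').carrier := hedge ▸ ha
      have hzT'c := ((mem_edge_iff T' a').1 hzT').1
      have hT' : T' ∈ crossing 𝒯 y := ⟨z T, hzT'c, hzy T hT⟩
      have hlt : z T' 0 < z T 0 := by
        have := hmin T' hT' _ hmem (by simp [horizontal_snd, hzy T hT])
        simp only [PiLp.add_apply, PiLp.smul_apply, horizontal_fst, smul_eq_mul] at this
        linarith
      have hnot : T' ∉ L T' := by simp [L]
      have hsub : insert T' (L T') ⊆ L T := by
        intro S hS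
        rcases Finset.mem_insert.1 hS with rfl | hS
        · exact Finset.mem_filter.2 ⟨Finset.mem_univ _, hT', hlt⟩
        · obtain ⟨-, h, h'⟩ := Finset.mem_filter.1 hS
          exact Finset.mem_filter.2 ⟨Finset.mem_univ _, h, h'.trans hlt⟩
      have hcard : (L T').card < n := by
        rw [← hn]
        refine lt_of_lt_of_le ?_ (Finset.card_le_card hsub)
        rw [Finset.card_insert_of_notMem hnot]
        exact Nat.lt_succ_self _
      have h4 := ih _ hcard T' rfl (z T) hzT'c (hzy T hT)
      have h5 := hjump T' a' _ hzT'
      rw [hedge] at h5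
      have h6 := Finset.sum_le_sum_of_subset_of_nonneg hsub (f := K) fun T _ _ => hK T
      rw [Finset.sum_insert hnot] at h6
      have h7 : |v.vb (T.edge a) (z T)| ≤ K T' + |v.v0 T' (z T)| := by
        have := abs_add_le (v.vb (T.edge a) (z T) - v.v0 T' (z T)) (v.v0 T' (z T))
        rw [sub_add_cancel] at this
        linarith
      linarith
  have hT : T ∈ crossing 𝒯 y := ⟨x, hx, hxy⟩
  refine (key _ T rfl x hx hxy).trans ?_
  have hnot : T ∉ L T := by simp [L]
  have hsub : insert T (L T) ⊆ Finset.univ.filter fun T' => T' ∈ crossing 𝒯 y := by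
    intro S hS
    rcases Finset.mem_insert.1 hS with rfl | hS
    · simpa using hT
    · exact Finset.mem_filter.2 ⟨Finset.mem_univ _, (Finset.mem_filter.1 hS).2.1⟩
  have h6 := Finset.sum_le_sum_of_subset_of_nonneg hsub (f := K) fun T _ _ => hK T
  rw [Finset.sum_insert hnot] at h6
  rw [← Finset.sum_filter]
  linarith [hK T]

/-! ### Areas -/

theorem measurableSet_of_coord {s t : Set ℝ} (hs : MeasurableSet s) (ht : MeasurableSet t) :
    MeasurableSet {x : Plane | x 0 ∈ s ∧ x 1 ∈ t} :=
  (hs.preimage (by fun_prop : Measurable fun x : Plane => x 0)).inter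
    (ht.preimage (by fun_prop : Measurable fun x : Plane => x 1))

theorem volume_coord_prod {s t : Set ℝ} (hs : MeasurableSet s) (ht : MeasurableSet t) :
    volume {x : Plane | x 0 ∈ s ∧ x 1 ∈ t} = volume s * volume t := by
  rw [← measurePreserving_pair.measure_preimage (measurableSet_of_coord hs ht).nullMeasurableSet,
    ← Measure.prod_prod]
  rfl

theorem ae_snd_ne (c : ℝ) : ∀ᵐ x : Plane, x 1 ≠ c := by
  have h := volume_coord_prod MeasurableSet.univ (measurableSet_singleton c)
  rw [Real.volume_singleton, mul_zero] at h
  rw [ae_iff]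
  simpa using h

/-- The rectangle of width `2 D` and height `2 h` centred at the point `(0, c)`. -/
def strip (D h c : ℝ) : Set Plane := {x | x 0 ∈ Icc (-D) D ∧ x 1 ∈ Icc (c - h) (c + h)}

theorem measurableSet_strip (D h c : ℝ) : MeasurableSet (strip D h c) :=
  measurableSet_of_coord measurableSet_Icc measurableSet_Icc

theorem volume_strip {D h : ℝ} (hD : 0 ≤ D) (c : ℝ) :
    volume (strip D h c) = ENNReal.ofReal (4 * D * h) := by
  rw [strip, volume_coord_prod measurableSet_Icc measurableSet_Icc, Real.volume_Icc,
    Real.volume_Icc, ← ENNReal.ofReal_mul (by linarith)]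
  congr 1
  ring

theorem aedisjoint_carrier {T T' : 𝒯.Triangle} (h : T ≠ T') :
    AEDisjoint volume T.carrier T'.carrier := by
  obtain ⟨a, haT, haT'⟩ : ∃ a ∈ T.1, a ∉ T'.1 := by
    by_contra! hsub
    exact h (Subtype.ext (Finset.eq_of_subset_of_card_le hsub (by rw [T.2.2, T'.2.2])))
  refine measure_mono_null (fun x hx => ?_)
    ((convex_convexHull ℝ (T.1 : Set Plane)).addHaar_frontier volume)
  refine ⟨subset_closure hx.1, fun hint => ?_⟩
  have hm : x ∈ convexHull ℝ ((T.1 : Set Plane) ∩ T'.1) := by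
    rw [← 𝒯.complex.convexHull_inter_convexHull T.2.1 T'.2.1]
    exact hx
  have h0 := coord_eq_zero_of_mem_convexHull T (a := ⟨a, haT⟩) inter_subset_left
    (fun h => haT' h.2) hm
  rw [← range_bary, AffineBasis.interior_convexHull] at hint
  exact (hint ⟨a, haT⟩).ne' h0

theorem sum_volume_real_inter_le {s : Set Plane} (hfin : volume s ≠ ⊤)
    (F : Finset 𝒯.Triangle) : ∑ T ∈ F, volume.real (T.carrier ∩ s) ≤ volume.real s := by
  have h := sum_measure_le_measure_univ (μ := volume.restrict s) (s := F)
    (t := fun T => T.carrier)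
    (fun T _ => (isCompact_carrier T).measurableSet.nullMeasurableSet)
    (fun T _ T' _ hne => Measure.restrict_le_self.absolutelyContinuous (aedisjoint_carrier hne))
  simp only [Measure.restrict_apply_univ] at h
  simp_rw [Measure.restrict_apply (isCompact_carrier _).measurableSet] at h
  have hne : ∀ T : 𝒯.Triangle, volume (T.carrier ∩ s) ≠ ⊤ := fun T =>
    measure_ne_top_of_subset inter_subset_right hfin
  simp only [Measure.real]
  rw [← ENNReal.toReal_sum fun T _ => hne T]
  exact ENNReal.toReal_mono hfin h

theorem mem_strip_of_mem_crossing {D h : ℝ} (hD : closure Ω ⊆ Metric.closedBall 0 D)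
    {T : 𝒯.Triangle} (hdiam : Metric.diam T.carrier ≤ h) {p x : Plane} (hp : p ∈ T.carrier)
    (hx : x ∈ closure Ω) (hT : T ∈ crossing 𝒯 (x 1)) : x ∈ strip D h (p 1) := by
  have h0 : |x 0| ≤ D :=
    (PiLp.norm_apply_le x 0).trans (mem_closedBall_zero_iff.1 (hD hx))
  obtain ⟨y, hy, hyx⟩ := hT
  have h1 : |y 1 - p 1| ≤ h := by
    have h2 := PiLp.norm_apply_le (y - p) 1
    rw [← dist_eq_norm] at h2
    exact h2.trans ((Metric.dist_le_diam_of_mem (isCompact_carrier T).isBounded hy hp).trans hdiam)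
  rw [hyx, abs_le] at h1
  exact ⟨abs_le.1 h0, by linarith, by linarith⟩

/-- The number of triangles that meet a horizontal line is at most of the order of the inverse of
the mesh size: such triangles contain essentially disjoint discs, in a strip around the line. -/
theorem card_crossing_le {D h κ : ℝ} (hD0 : 0 ≤ D) (hD : closure Ω ⊆ Metric.closedBall 0 D)
    (hκ : 0 < κ) (hh : 0 < h) (hdiam : ∀ T : 𝒯.Triangle, Metric.diam T.carrier ≤ h)
    (hball : ∀ T : 𝒯.Triangle, ∃ x, Metric.closedBall x (κ * h) ⊆ T.carrier) (y : ℝ)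
    (F : Finset 𝒯.Triangle) (hF : ∀ T ∈ F, T ∈ crossing 𝒯 y) :
    (F.card : ℝ) ≤ 2 * D / (κ ^ 2 * h) := by
  have hsub : ∀ T ∈ F, T.carrier ∩ strip D h y = T.carrier := by
    intro T hT
    refine inter_eq_left.2 fun x hx => ?_
    obtain ⟨p, hp, hpy⟩ := hF T hT
    rw [← hpy]
    exact mem_strip_of_mem_crossing hD (hdiam T) hp (carrier_subset_closure T hx) ⟨x, hx, rfl⟩
  have hvol : ∀ T : 𝒯.Triangle, 3 * (κ * h) ^ 2 ≤ volume.real T.carrier := by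
    intro T
    obtain ⟨x, hx⟩ := hball T
    refine le_trans ?_ (measureReal_mono hx (isCompact_carrier T).measure_lt_top.ne)
    rw [Measure.real, EuclideanSpace.volume_closedBall_fin_two,
      ← ENNReal.ofReal_pow (by positivity), ENNReal.toReal_mul,
      ENNReal.toReal_ofReal (by positivity)]
    rw [ENNReal.toReal_ofReal Real.pi_nonneg]
    nlinarith [Real.pi_gt_three, sq_nonneg (κ * h)]
  have h1 := sum_volume_real_inter_le (s := strip D h y)
    (by rw [volume_strip hD0]; exact ENNReal.ofReal_ne_top) F
  rw [Finset.sum_congr rfl fun T hT => by rw [hsub T hT], Measure.real, volume_strip hD0,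
    ENNReal.toReal_ofReal (by positivity)] at h1
  have h2 := Finset.card_nsmul_le_sum F _ _ fun T _ => hvol T
  rw [nsmul_eq_mul] at h2
  rw [le_div_iff₀ (by positivity)]
  have h3 : h * ((F.card : ℝ) * (κ ^ 2 * h)) ≤ h * (2 * D) := by nlinarith [mul_nonneg hD0 hh.le]
  exact le_of_mul_le_mul_left h3 hh

theorem diam_le_meshSize (T : 𝒯.Triangle) : Metric.diam T.carrier ≤ 𝒯.meshSize :=
  le_ciSup (f := fun T : 𝒯.Triangle => Metric.diam T.carrier) (Set.finite_range _).bddAbove T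

theorem meshSize_pos (T : 𝒯.Triangle) : 0 < 𝒯.meshSize := by
  refine lt_of_lt_of_le (Metric.diam_pos ?_ (isCompact_carrier T).isBounded) (diam_le_meshSize T)
  have h : 1 < T.1.card := by rw [T.2.2]; norm_num
  exact (Finset.one_lt_card_iff_nontrivial.1 h).mono (subset_convexHull ℝ _)

/-! ### The discrete Poincaré inequality -/

open Classical in
/-- At almost every point of a triangle, the interior part is bounded by its oscillations and jumps
`K` on the triangles near the horizontal line through this point. -/
theorem ae_sq_v0_le {D κ : ℝ} (hΩ : IsOpen Ω) (hD0 : 0 ≤ D)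
    (hD : closure Ω ⊆ Metric.closedBall 0 D) (hκ : 0 < κ)
    (hball : ∀ T : 𝒯.Triangle, ∃ x, Metric.closedBall x (κ * 𝒯.meshSize) ⊆ T.carrier)
    {j l : ℕ} {v : Sh 𝒯 j l} (hv : v ∈ Sh0 𝒯 j l) {K : 𝒯.Triangle → ℝ} (hK : ∀ T, 0 ≤ K T)
    (hosc : ∀ T, ∀ x ∈ T.carrier, ∀ y ∈ T.carrier, |v.v0 T x - v.v0 T y| ≤ K T)
    (hjump : ∀ T : 𝒯.Triangle, ∀ a, ∀ x ∈ (T.edge a).carrier,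
      |v.vb (T.edge a) x - v.v0 T x| ≤ K T)
    {p : 𝒯.Triangle → Plane} (hp : ∀ T, p T ∈ T.carrier) (T : 𝒯.Triangle) :
    ∀ᵐ x ∂(volume.restrict T.carrier), v.v0 T x ^ 2 ≤
      18 * D / (κ ^ 2 * 𝒯.meshSize) *
        ∑ S, K S ^ 2 * (strip D 𝒯.meshSize (p S 1)).indicator 1 x := by
  have hh := meshSize_pos T
  have hgen : ∀ᵐ x : Plane, ∀ S : 𝒯.Triangle, ∀ w : S.vertices, x 1 ≠ w.1 1 :=
    ae_all_iff.2 fun S => ae_all_iff.2 fun w => ae_snd_ne _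
  filter_upwards [ae_restrict_of_ae hgen, ae_restrict_mem (isCompact_carrier T).measurableSet]
    with x hx hxT
  have h1 := abs_v0_le_sum_crossing hΩ hv hK hosc hjump
    (fun S w hw => (hx S ⟨w, hw⟩).symm) T hxT rfl
  rw [← Finset.sum_filter] at h1
  set F := Finset.univ.filter fun S => S ∈ crossing 𝒯 (x 1) with hF
  have h2 := card_crossing_le hD0 hD hκ hh diam_le_meshSize hball (x 1) F
    (fun S hS => (Finset.mem_filter.1 hS).2)
  have h3 : (∑ S ∈ F, K S) ^ 2 ≤ F.card * ∑ S ∈ F, K S ^ 2 := sq_sum_le_card_mul_sum_sq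
  have h4 : ∑ S ∈ F, K S ^ 2 ≤
      ∑ S, K S ^ 2 * (strip D 𝒯.meshSize (p S 1)).indicator 1 x := by
    rw [hF, Finset.sum_filter]
    refine Finset.sum_le_sum fun S _ => ?_
    split_ifs with hS
    · have hmem := mem_strip_of_mem_crossing hD (diam_le_meshSize S) (hp S)
        (carrier_subset_closure T hxT) hS
      rw [indicator_of_mem hmem, Pi.one_apply, mul_one]
    · exact mul_nonneg (sq_nonneg _) (indicator_nonneg (fun _ _ => zero_le_one) _)
  have h5 : 0 ≤ ∑ S ∈ F, K S ^ 2 := Finset.sum_nonneg fun _ _ => sq_nonneg _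
  calc v.v0 T x ^ 2 = |v.v0 T x| ^ 2 := (sq_abs _).symm
    _ ≤ (3 * ∑ S ∈ F, K S) ^ 2 := pow_le_pow_left₀ (abs_nonneg _) h1 2
    _ = 9 * (∑ S ∈ F, K S) ^ 2 := by ring
    _ ≤ 9 * (F.card * ∑ S ∈ F, K S ^ 2) := by linarith
    _ ≤ 9 * (2 * D / (κ ^ 2 * 𝒯.meshSize) *
        ∑ S, K S ^ 2 * (strip D 𝒯.meshSize (p S 1)).indicator 1 x) := by
      refine mul_le_mul_of_nonneg_left (mul_le_mul h2 h4 h5 ?_) (by norm_num)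
      positivity
    _ = _ := by ring

/-- A Poincaré inequality for discrete functions: oscillations and jumps control the `L²` norm,
with a constant independent of the mesh. -/
theorem sum_integral_sq_v0_le {D κ : ℝ} (hΩ : IsOpen Ω) (hD0 : 0 ≤ D)
    (hD : closure Ω ⊆ Metric.closedBall 0 D) (hκ : 0 < κ)
    (hball : ∀ T : 𝒯.Triangle, ∃ x, Metric.closedBall x (κ * 𝒯.meshSize) ⊆ T.carrier)
    {j l : ℕ} {v : Sh 𝒯 j l} (hv : v ∈ Sh0 𝒯 j l) {K : 𝒯.Triangle → ℝ} (hK : ∀ T, 0 ≤ K T)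
    (hosc : ∀ T, ∀ x ∈ T.carrier, ∀ y ∈ T.carrier, |v.v0 T x - v.v0 T y| ≤ K T)
    (hjump : ∀ T : 𝒯.Triangle, ∀ a, ∀ x ∈ (T.edge a).carrier,
      |v.vb (T.edge a) x - v.v0 T x| ≤ K T) :
    ∑ T : 𝒯.Triangle, ∫ x in T.carrier, v.v0 T x ^ 2 ≤
      72 * D ^ 2 / κ ^ 2 * ∑ T, K T ^ 2 := by
  rcases isEmpty_or_nonempty 𝒯.Triangle with hemp | ⟨⟨T₀⟩⟩
  · simp
  have hh := meshSize_pos T₀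
  set h := 𝒯.meshSize with hdef
  choose p hp using fun T : 𝒯.Triangle => (interior_carrier_nonempty T).mono interior_subset
  set M := 18 * D / (κ ^ 2 * h) with hM
  have hM0 : 0 ≤ M := by positivity
  have hst : ∀ S : 𝒯.Triangle, volume (strip D h (p S 1)) ≠ ⊤ := fun S => by
    rw [volume_strip hD0]; exact ENNReal.ofReal_ne_top
  have hint : ∀ T S : 𝒯.Triangle, IntegrableOn
      (fun x => K S ^ 2 * (strip D h (p S 1)).indicator (1 : Plane → ℝ) x) T.carrier :=
    fun T S => by
      have h1 : IntegrableOn (1 : Plane → ℝ) T.carrier :=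
        continuous_one.continuousOn.integrableOn_compact (isCompact_carrier T)
      exact (h1.indicator (measurableSet_strip _ _ _)).integrable.const_mul _
  have hT : ∀ T : 𝒯.Triangle, ∫ x in T.carrier, v.v0 T x ^ 2 ≤
      M * ∑ S, K S ^ 2 * volume.real (T.carrier ∩ strip D h (p S 1)) := by
    intro T
    have hvc : ContinuousOn (fun x => v.v0 T x ^ 2) T.carrier :=
      (Sh.continuousOn_of_isPolyOn (v.v0_poly T)).pow 2
    refine (integral_mono_ae (hvc.integrableOn_compact (isCompact_carrier T))
      ((integrable_finsetSum _ fun S _ => hint T S).const_mul _)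
      (ae_sq_v0_le hΩ hD0 hD hκ hball hv hK hosc hjump hp T)).trans_eq ?_
    rw [integral_const_mul, integral_finsetSum _ fun S _ => hint T S]
    congr 1
    refine Finset.sum_congr rfl fun S _ => ?_
    rw [integral_const_mul, integral_indicator_one (measurableSet_strip _ _ _),
      measureReal_restrict_apply (measurableSet_strip _ _ _), inter_comm]
  calc ∑ T : 𝒯.Triangle, ∫ x in T.carrier, v.v0 T x ^ 2
      ≤ ∑ T : 𝒯.Triangle, M * ∑ S, K S ^ 2 * volume.real (T.carrier ∩ strip D h (p S 1)) :=
        Finset.sum_le_sum fun T _ => hT T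
    _ = M * ∑ S, K S ^ 2 * ∑ T : 𝒯.Triangle, volume.real (T.carrier ∩ strip D h (p S 1)) := by
        rw [← Finset.mul_sum, Finset.sum_comm]
        simp_rw [Finset.mul_sum]
    _ ≤ M * ∑ S, K S ^ 2 * (4 * D * h) := by
        refine mul_le_mul_of_nonneg_left (Finset.sum_le_sum fun S _ => ?_) hM0
        refine mul_le_mul_of_nonneg_left ?_ (sq_nonneg _)
        refine (sum_volume_real_inter_le (hst S) _).trans_eq ?_
        rw [Measure.real, volume_strip hD0, ENNReal.toReal_ofReal (by positivity)]
    _ = 72 * D ^ 2 / κ ^ 2 * ∑ T, K T ^ 2 := by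
        rw [← Finset.sum_mul, hM]
        field_simp
        ring

end WeakGalerkin

end

theorem lemma4p2 {Ω : Set WeakGalerkin.Plane} (hΩ : WeakGalerkin.IsPolygonalDomain Ω)
    {ι : Type*} (𝒯 : ι → WeakGalerkin.Triangulation Ω) (h𝒯 : WeakGalerkin.QuasiUniform 𝒯)
    (j : ℕ) :
    ∃ C : ℝ, 0 < C ∧ ∀ (i : ι) (φ : WeakGalerkin.Sh (𝒯 i) j j),
      φ ∈ WeakGalerkin.Sh0 (𝒯 i) j j → φ.l2Norm ≤ C * φ.l2NormWeakGradient j := by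
  obtain ⟨κ, hκ, hball⟩ := h𝒯
  obtain ⟨C₀, hC₀, hloc⟩ := WeakGalerkin.exists_local_stability j hκ
  obtain ⟨D, hD0, hD⟩ := hΩ.isBounded.closure.subset_closedBall_lt 0 0
  refine ⟨9 * D * C₀ / κ, by positivity, fun i φ hφ => ?_⟩
  let K : (𝒯 i).Triangle → ℝ := fun T =>
    C₀ * √(∫ x in T.carrier, ‖(φ.weakGradient j T).1.at x‖ ^ 2)
  choose z hz using hball i
  have hl := fun T : (𝒯 i).Triangle => hloc φ T (𝒯 i).meshSize (z T)
    (WeakGalerkin.meshSize_pos T) (WeakGalerkin.diam_le_meshSize T) (hz T)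
  have hmain := WeakGalerkin.sum_integral_sq_v0_le hΩ.isOpen hD0.le hD hκ (hball i) hφ (K := K)
    (fun T => by positivity) (fun T => (hl T).1) (fun T => (hl T).2)
  have hK : ∀ T, K T ^ 2 = C₀ ^ 2 * ∫ x in T.carrier, ‖(φ.weakGradient j T).1.at x‖ ^ 2 :=
    fun T => by
      simp only [K]
      rw [mul_pow, Real.sq_sqrt (MeasureTheory.integral_nonneg fun _ => sq_nonneg _)]
  simp_rw [hK] at hmain
  rw [← Finset.mul_sum] at hmain
  rw [WeakGalerkin.Sh.l2Norm, WeakGalerkin.Sh.l2NormWeakGradient]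
  set G := ∑ T : (𝒯 i).Triangle, ∫ x in T.carrier, ‖(φ.weakGradient j T).1.at x‖ ^ 2 with hG
  have hG0 : 0 ≤ G := Finset.sum_nonneg fun _ _ =>
    MeasureTheory.integral_nonneg fun _ => sq_nonneg _
  rw [Real.sqrt_le_iff]
  refine ⟨by positivity, hmain.trans ?_⟩
  rw [mul_pow, Real.sq_sqrt hG0]
  have hnn : 0 ≤ D ^ 2 / κ ^ 2 * (C₀ ^ 2 * G) := by positivity
  have h1 : (9 * D * C₀ / κ) ^ 2 * G = 81 * (D ^ 2 / κ ^ 2 * (C₀ ^ 2 * G)) := by ring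
  have h2 : 72 * D ^ 2 / κ ^ 2 * (C₀ ^ 2 * G) = 72 * (D ^ 2 / κ ^ 2 * (C₀ ^ 2 * G)) := by ring
  rw [h1, h2]
  linarith
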